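/- **Theorem 1.** Let $A\in\mathbb R^{n\times n}$, $B,C\in\mathbb R^n$, $\Lambda\in\mathbb R$, and consider the single-input single-output plant $$\dot x=Ax+B\Lambda u,\qquad y=C^Tx,$$ and the closed-loop reference model $$\dot x_m=A_mx_m+Br-L(y-y_m),\qquad y_m=C^Tx_m,$$ where $A_m$ is Hurwitz and the reference input $r:[0,\infty)\to\mathbb R$ is bounded and measurable. With $e_y=y-y_m$ and $M=C^TB$, the control and the update laws are $$u=\Theta^T(t)x_m+K(t)\,r,\qquad \dot\Theta=-\Gamma_\theta x_m e_yM,\qquad \dot K=-\Gamma_k\, r\,e_yM,$$ where $\Gamma_\theta$ is a diagonal matrix with positive diagonal entries and $\Gamma_k>0$. Assume: 1. $C^TB\neq0$. 2. The pair $\{A_m,C^T\}$ is observable. 3. The plant is minimum phase: every complex zero of the polynomial $\psi(s)=\det(sI-A)\,C^T(sI-A)^{-1}B\Lambda$ has negative real part. 4. There are $\Theta^*\in\mathbb R^n$ with $A+B\Lambda\Theta^{*T}=A_m$ and $K^*\in\mathbb R$ with $\Lambda K^*=1$. 5. $\Lambda>0$. 6. Upper bounds $\|\Theta^*\|\le\bar\theta^*$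 (Euclidean norm) and $|\Lambda|\le\bar\lambda$ are known. Then the following hold. (a) For every $\sigma>0$ there is $L_s\in\mathbb R^n$ such that, as rational functions of $s$, $$C^T(sI-A_m-L_sC^T)^{-1}B=\frac{C^TB}{s+\sigma}.\tag{1}$$ (b) For every $\sigma>0$ and every $L_s$ satisfying (1), there are symmetric positive definite matrices $P$ and $Q_s$ with $$(A_m+L_sC^T)^TP+P(A_m+L_sC^T)=-Q_s,\qquad PB=CM.\tag{2}$$ (c) For every $\sigma>0$, every $L_s$ satisfying (1), all symmetric positive definite $P,Q_s$ satisfying (2), and every $$\rho>\rho^*=\frac{\bar\lambda^2\bar\theta^{*2}}{2\lambda_{\min}(Q_s)},$$ the closed loop with $L=L_s-\rho BM^T$ has the following properties. From every initial state $(x,x_m,\Theta,K)(0)$ there is a solution on $[0,\infty)$. For every $R$ there is a $b$ such that every solution $(x,x_m,\Theta,K)$, on any interval $I\subseteq[0,\infty)$ containing $0$, whose initial state has norm at most $R$, has norm at most $b$ at all times in $I$. Every solution on $[0,\infty)$ satisfies $\lim_{t\to\infty}e_y(t)=0$. Solutions are continuous functions that satisfy the integrated differential equations (for continuous $r$ these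 are the classical solutions). -/

import Mathlib

open Matrix Set Filter Topology MeasureTheory

noncomputable section

namespace AdaptiveSISO

/-- The complex matrix `s I - A` attached to a real square matrix `A`. -/
def resolventMatrix {n : ℕ} (A : Matrix (Fin n) (Fin n) ℝ) (s : ℂ) : Matrix (Fin n) (Fin n) ℂ :=
  s • (1 : Matrix (Fin n) (Fin n) ℂ) - A.map (fun a : ℝ => (a : ℂ))

/-- The transfer function `Cᵀ (s I - A)⁻¹ B` of a single-input single-output system, at a complex
number `s` with `det (s I - A) ≠ 0`. -/
def transferFunction {n : ℕ} (A : Matrix (Fin n) (Fin n) ℝ) (B C : Fin n → ℝ) (s : ℂ) : ℂ :=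
  (fun i => (C i : ℂ)) ⬝ᵥ ((resolventMatrix A s)⁻¹ *ᵥ (fun i => (B i : ℂ)))

/-- The polynomial `ψ(s) = det (s I - A) · Cᵀ (s I - A)⁻¹ B = Cᵀ adj (s I - A) B`, whose zeros are
the transmission zeros. The adjugate gives its value also at the eigenvalues of `A`;
`zeroPolynomial_eq` is the agreement with the first expression. -/
def zeroPolynomial {n : ℕ} (A : Matrix (Fin n) (Fin n) ℝ) (B C : Fin n → ℝ) (s : ℂ) : ℂ :=
  (fun i => (C i : ℂ)) ⬝ᵥ ((resolventMatrix A s).adjugate *ᵥ (fun i => (B i : ℂ)))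

theorem zeroPolynomial_eq {n : ℕ} (A : Matrix (Fin n) (Fin n) ℝ) (B C : Fin n → ℝ) (s : ℂ)
    (hs : (resolventMatrix A s).det ≠ 0) :
    zeroPolynomial A B C s = (resolventMatrix A s).det * transferFunction A B C s := by
  unfold zeroPolynomial transferFunction
  rw [Matrix.inv_def, Matrix.smul_mulVec, dotProduct_smul, Ring.inverse_eq_inv', smul_eq_mul,
    mul_inv_cancel_left₀ hs]

/-- Minimum phase: all transmission zeros lie in the open left half plane. -/
def IsMinimumPhase {n : ℕ} (A : Matrix (Fin n) (Fin n) ℝ) (B C : Fin n → ℝ) : Prop :=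
  ∀ s : ℂ, zeroPolynomial A B C s = 0 → s.re < 0

/-- All (complex) eigenvalues lie in the open left half plane. -/
def IsHurwitz {n : ℕ} (A : Matrix (Fin n) (Fin n) ℝ) : Prop :=
  ∀ s : ℂ, (resolventMatrix A s).det = 0 → s.re < 0

/-- The pair `{A, Cᵀ}` is observable: the matrix with rows `Cᵀ, CᵀA, …, CᵀAⁿ⁻¹` has rank `n`. -/
def IsObservable {n : ℕ} (A : Matrix (Fin n) (Fin n) ℝ) (C : Fin n → ℝ) : Prop :=
  (Matrix.of fun k : Fin n => C ᵥ* A ^ (k : ℕ)).rank = n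

/-- The output injection gain `Ls` makes the transfer function from `B` to `Cᵀ` equal to
`a / (s + σ)` with `a = CᵀB`, as rational functions of `s`. -/
def PlacesSinglePole {n : ℕ} (Am : Matrix (Fin n) (Fin n) ℝ) (B C Ls : Fin n → ℝ) (σ : ℝ) : Prop :=
  ∀ s : ℂ, (resolventMatrix (Am + vecMulVec Ls C) s).det ≠ 0 → s ≠ -(σ : ℂ) →
    transferFunction (Am + vecMulVec Ls C) B C s = ((C ⬝ᵥ B : ℝ) : ℂ) / (s + (σ : ℂ))

/-- `P` and `Qs` are symmetric positive definite with
`(Am + Ls Cᵀ)ᵀ P + P (Am + Ls Cᵀ) = -Qs` and `P B = C M`, where `M = CᵀB`. -/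
def IsLyapunovPair {n : ℕ} (Am : Matrix (Fin n) (Fin n) ℝ) (B C Ls : Fin n → ℝ)
    (P Qs : Matrix (Fin n) (Fin n) ℝ) : Prop :=
  P.PosDef ∧ Qs.PosDef ∧
    (Am + vecMulVec Ls C)ᵀ * P + P * (Am + vecMulVec Ls C) = -Qs ∧
    P *ᵥ B = (C ⬝ᵥ B) • C

/-- The smallest eigenvalue of a real symmetric matrix. -/
def minEigenvalue {n : ℕ} (Q : Matrix (Fin n) (Fin n) ℝ) : ℝ := sInf (spectrum ℝ Q)

/-- The data of the closed loop: plant `(A, B, Λ, C)`, reference model `(Am, L)`, mixing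
gain `M` and adaptation gains `Γθ`, `Γk`. -/
structure Loop (n : ℕ) where
  A : Matrix (Fin n) (Fin n) ℝ
  B : Fin n → ℝ
  C : Fin n → ℝ
  lam : ℝ
  Am : Matrix (Fin n) (Fin n) ℝ
  L : Fin n → ℝ
  M : ℝ
  Γθ : Matrix (Fin n) (Fin n) ℝ
  Γk : ℝ

/-- The closed-loop state `(x, x_m, Θ, K)`. -/
abbrev State (n : ℕ) : Type := (Fin n → ℝ) × (Fin n → ℝ) × (Fin n → ℝ) × ℝ

namespace Loop

variable {n : ℕ}

/-- The output error `e_y = y - y_m = Cᵀ x - Cᵀ x_m`. -/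
def outputError (S : Loop n) : State n → ℝ
  | (x, xm, _, _) => S.C ⬝ᵥ x - S.C ⬝ᵥ xm

/-- The control `u = Θᵀ x_m + Kᵀ r`, for the reference value `r`. -/
def control (r : ℝ) : State n → ℝ
  | (_, xm, Θ, K) => Θ ⬝ᵥ xm + K * r

/-- The right-hand side of the closed-loop differential equation, for the reference value `r`:
`x' = A x + B Λ u`, `x_m' = Am x_m + B r - L e_y`, `Θ' = -Γθ x_m e_y M`, `K' = -Γk r e_y M`. -/
def field (S : Loop n) (r : ℝ) : State n → State n
  | (x, xm, Θ, K) =>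
    let u := control r (x, xm, Θ, K)
    let ey := S.outputError (x, xm, Θ, K)
    (S.A *ᵥ x + (S.lam * u) • S.B,
      S.Am *ᵥ xm + r • S.B - ey • S.L,
      -((ey * S.M) • (S.Γθ *ᵥ xm)),
      -(S.Γk * r * ey * S.M))

/-- `X` solves the closed-loop equation on the interval `I ∋ 0` with reference input `r`, in the
sense of Carathéodory: `X` is continuous and satisfies the integrated equation. (At every point
of continuity of `r`, such an `X` satisfies the differential equation.) -/
def IsSolutionOn (S : Loop n) (r : ℝ → ℝ) (X : ℝ → State n) (I : Set ℝ) : Prop :=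
  ContinuousOn X I ∧ ∀ t ∈ I, X t = X 0 + ∫ s in (0 : ℝ)..t, S.field (r s) (X s)

end Loop

end AdaptiveSISO

end

/-! The algebra rests on the matrix determinant lemma: with N(A,u,v) = vᵀ adj(X - A) u, the
characteristic polynomial of A + u vᵀ is that of A minus N(A,u,v). Hence N(A,B,C) is unchanged by
output injection and by state feedback, and its coefficient in degree n - 1 is CᵀB.

(a) Observability makes l ↦ N(A_m,l,C) a bijection onto the polynomials of degree below n, so output
injection reaches every monic characteristic polynomial of degree n. The choice N(A_m,B,C)(X +
σ)/CᵀB cancels all zeros (`exists_placesSinglePole`).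

(b) Conversely, this cancellation and observability force FB = -σB for F = A_m + L_s Cᵀ
(`PlacesSinglePole.mulVec_eq`). Let Z be the projection onto ker Cᵀ along B. Then ZF = GZ for a
matrix G with the spectrum of F, which consists of -σ and transmission zeros, so G is Hurwitz and
has a Lyapunov matrix P₀. For large κ, P = CCᵀ + κ ZᵀP₀Z works, and PB = CM because ZB = 0
(`exists_isLyapunovPair`).

(c) Let e = x - x_m. Along solutions the quadratic energy in e and the parameter errors has
derivative -eᵀQ_s e - 2ρ(M e_y)² - 2 M e_y ΛΘ*ᵀe. The last term survives because the control feeds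
back x_m and not x; the ρ term absorbs it exactly when ρ > ρ*. This bounds e, Θ and K, and then x_m,
which is driven through a Hurwitz matrix by bounded terms. The a priori bound gives global
existence. Finally e_y is Lipschitz with integrable square, hence tends to 0. As r is only
measurable, derivatives along solutions exist almost everywhere and are used through absolute
continuity. -/

noncomputable section

namespace AdaptiveSISO

/-! ### Rank-one perturbations of the characteristic polynomial -/

section Determinant

variable {ι : Type*} [Fintype ι] [DecidableEq ι]

/-- The matrix determinant lemma over an integral domain. -/
theorem det_add_vecMulVec {R : Type*} [CommRing R] [IsDomain R] {M : Matrix ι ι R}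
    (hM : M.det ≠ 0) (u v : ι → R) :
    (M + vecMulVec u v).det = M.det + v ⬝ᵥ (M.adjugate *ᵥ u) := by
  -- In the fraction field a nonzero determinant is a unit, so the invertible case applies.
  let f := algebraMap R (FractionRing R)
  have hf : Function.Injective f := IsFractionRing.injective R (FractionRing R)
  have hdet : (M.map f).det = f M.det := (f.map_det M).symm
  have hu : IsUnit (M.map f).det := by
    rw [hdet, isUnit_iff_ne_zero]
    exact (map_ne_zero_iff f hf).2 hM
  have key := det_add_replicateCol_mul_replicateRow (ι := Unit) hu (f ∘ u) (f ∘ v)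
  apply hf
  have h1 : f (M + vecMulVec u v).det =
      (M.map f + replicateCol Unit (f ∘ u) * replicateRow Unit (f ∘ v)).det := by
    rw [f.map_det]
    congr 1
    ext i j
    simp [Matrix.mul_apply, vecMulVec_apply]
  rw [h1, key, hdet, det_unique (n := Unit), Matrix.add_apply, Matrix.one_apply_eq, mul_add, mul_one,
    map_add]
  congr 1
  have h2 : f (v ⬝ᵥ (M.adjugate *ᵥ u)) = (f ∘ v) ⬝ᵥ ((M.map f).adjugate *ᵥ (f ∘ u)) := by
    rw [RingHom.map_dotProduct]
    congr 1
    have : (M.map f).adjugate = M.adjugate.map f := (f.map_adjugate M).symm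
    rw [this]
    ext i
    exact RingHom.map_mulVec f _ _ i
  rw [h2, Matrix.inv_def, Matrix.mul_assoc, Matrix.smul_mul, Matrix.mul_smul, Matrix.smul_apply,
    smul_eq_mul, Ring.inverse_eq_inv', ← mul_assoc, hdet, mul_inv_cancel₀ (hdet ▸ hu.ne_zero), one_mul]
  simp [Matrix.mul_apply, dotProduct, mulVec]

/-- The numerator `vᵀ adj (X - A) u` of the transfer function `vᵀ (X - A)⁻¹ u`. -/
def numerator (A : Matrix ι ι ℝ) (u v : ι → ℝ) : Polynomial ℝ :=
  (Polynomial.C ∘ v) ⬝ᵥ (A.charmatrix.adjugate *ᵥ (Polynomial.C ∘ u))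

theorem numerator_add_left (A : Matrix ι ι ℝ) (u u' v : ι → ℝ) :
    numerator A (u + u') v = numerator A u v + numerator A u' v := by
  have : (Polynomial.C ∘ (u + u') : ι → Polynomial ℝ) = Polynomial.C ∘ u + Polynomial.C ∘ u' := by
    ext1 i; simp
  simp [numerator, this, Matrix.mulVec_add]

theorem numerator_add_right (A : Matrix ι ι ℝ) (u v v' : ι → ℝ) :
    numerator A u (v + v') = numerator A u v + numerator A u v' := by
  have : (Polynomial.C ∘ (v + v') : ι → Polynomial ℝ) = Polynomial.C ∘ v + Polynomial.C ∘ v' := by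
    ext1 i; simp
  simp [numerator, this]

theorem numerator_smul_left (A : Matrix ι ι ℝ) (c : ℝ) (u v : ι → ℝ) :
    numerator A (c • u) v = Polynomial.C c * numerator A u v := by
  have : (Polynomial.C ∘ (c • u) : ι → Polynomial ℝ) = Polynomial.C c • (Polynomial.C ∘ u) := by
    ext1 i; simp
  simp [numerator, this, Matrix.mulVec_smul]

/-- The determinant lemma for X - A, whose determinant is monic and so nonzero. Facts about
numerators can then be read off characteristic polynomials. -/
theorem charpoly_add_vecMulVec (A : Matrix ι ι ℝ) (u v : ι → ℝ) :
    (A + vecMulVec u v).charpoly = A.charpoly - numerator A u v := by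
  have h : (A + vecMulVec u v).charmatrix =
      A.charmatrix + vecMulVec (-(Polynomial.C ∘ u)) (Polynomial.C ∘ v) := by
    ext1 i j
    simp [charmatrix_apply, vecMulVec_apply]
    ring
  rw [Matrix.charpoly, h, det_add_vecMulVec A.charpoly_monic.ne_zero, Matrix.mulVec_neg,
    dotProduct_neg, sub_eq_add_neg]
  rfl

/-- Output injection leaves the numerator unchanged. -/
theorem numerator_outputInjection (A : Matrix ι ι ℝ) (l u v : ι → ℝ) :
    numerator (A + vecMulVec l v) u v = numerator A u v := by
  -- The characteristic polynomial of A + (l + u)vᵀ, computed in two steps and in one.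
  have h1 := charpoly_add_vecMulVec (A + vecMulVec l v) u v
  have h2 := charpoly_add_vecMulVec A (l + u) v
  rw [add_vecMulVec, ← add_assoc, h1, charpoly_add_vecMulVec, numerator_add_left] at h2
  linear_combination -h2

/-- State feedback leaves the numerator unchanged. -/
theorem numerator_stateFeedback (A : Matrix ι ι ℝ) (k u v : ι → ℝ) :
    numerator (A + vecMulVec u k) u v = numerator A u v := by
  have h1 := charpoly_add_vecMulVec (A + vecMulVec u k) u v
  have h2 := charpoly_add_vecMulVec A u (k + v)
  rw [vecMulVec_add, ← add_assoc, h1, charpoly_add_vecMulVec, numerator_add_right] at h2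
  linear_combination -h2

/-- From adj(X - A)(X - A) = det(X - A). -/
theorem numerator_mulVec (A : Matrix ι ι ℝ) (u v : ι → ℝ) :
    numerator A (A *ᵥ u) v =
      Polynomial.X * numerator A u v - Polynomial.C (v ⬝ᵥ u) * A.charpoly := by
  have h : (Polynomial.C ∘ (A *ᵥ u) : ι → Polynomial ℝ) =
      (Polynomial.X : Polynomial ℝ) • (Polynomial.C ∘ u) - A.charmatrix *ᵥ (Polynomial.C ∘ u) := by
    ext1 i
    have : (Polynomial.C (A.mulVec u i) : Polynomial ℝ) =
      (A.map Polynomial.C *ᵥ (Polynomial.C ∘ u)) i := RingHom.map_mulVec Polynomial.C _ _ i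
    simp only [Function.comp_apply, this, charmatrix, Matrix.sub_mulVec, Pi.sub_apply,
      RingHom.mapMatrix_apply]
    simp
  have h2 : (Polynomial.C (v ⬝ᵥ u) : Polynomial ℝ) = (Polynomial.C ∘ v) ⬝ᵥ (Polynomial.C ∘ u) :=
    RingHom.map_dotProduct _ _ _
  rw [numerator, h, Matrix.mulVec_sub, Matrix.mulVec_mulVec, adjugate_mul, h2, Matrix.mulVec_smul,
    dotProduct_sub, dotProduct_smul, Matrix.smul_mulVec, one_mulVec, dotProduct_smul]
  simp only [smul_eq_mul, numerator, Matrix.charpoly]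
  ring

theorem numerator_degree_lt (A : Matrix ι ι ℝ) (u v : ι → ℝ) :
    (numerator A u v).degree < Fintype.card ι := by
  have h : numerator A u v = A.charpoly - (A + vecMulVec u v).charpoly := by
    rw [charpoly_add_vecMulVec]; ring
  rw [h, ← A.charpoly_degree_eq_dim]
  refine Polynomial.degree_sub_lt_left ?_ A.charpoly_monic.ne_zero ?_
  · rw [charpoly_degree_eq_dim, charpoly_degree_eq_dim]
  · rw [A.charpoly_monic.leadingCoeff, (charpoly_monic _).leadingCoeff]

/-- The coefficient of a characteristic polynomial in this degree is minus the trace, and u vᵀ has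
trace vᵀu. -/
theorem numerator_coeff [Nonempty ι] (A : Matrix ι ι ℝ) (u v : ι → ℝ) :
    (numerator A u v).coeff (Fintype.card ι - 1) = v ⬝ᵥ u := by
  have h : numerator A u v = A.charpoly - (A + vecMulVec u v).charpoly := by
    rw [charpoly_add_vecMulVec]; ring
  have h1 := A.trace_eq_neg_charpoly_coeff
  have h2 := (A + vecMulVec u v).trace_eq_neg_charpoly_coeff
  rw [trace_add, trace_vecMulVec, dotProduct_comm] at h2
  rw [h, Polynomial.coeff_sub]
  linarith

end Determinant

/-! ### Observability and pole placement -/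

variable {n : ℕ}

theorem det_resolventMatrix (A : Matrix (Fin n) (Fin n) ℝ) (s : ℂ) :
    (resolventMatrix A s).det = Polynomial.aeval s A.charpoly := by
  have h : resolventMatrix A s = A.charmatrix.map (Polynomial.aeval s : Polynomial ℝ →ₐ[ℝ] ℂ) := by
    ext i j
    by_cases hij : i = j <;> simp [resolventMatrix, hij]
  rw [h]
  exact ((Polynomial.aeval s : Polynomial ℝ →ₐ[ℝ] ℂ).map_det _).symm

theorem zeroPolynomial_eq_aeval (A : Matrix (Fin n) (Fin n) ℝ) (B C : Fin n → ℝ) (s : ℂ) :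
    zeroPolynomial A B C s = Polynomial.aeval s (numerator A B C) := by
  let f : Polynomial ℝ →+* ℂ := (Polynomial.aeval s : Polynomial ℝ →ₐ[ℝ] ℂ)
  have h : resolventMatrix A s = A.charmatrix.map f := by
    ext i j
    by_cases hij : i = j <;> simp [f, resolventMatrix, hij]
  have hc (w : Fin n → ℝ) : (fun i => (w i : ℂ)) = f ∘ (Polynomial.C ∘ w) := by
    ext i; simp [f]
  have ha : (A.charmatrix.map f).adjugate = A.charmatrix.adjugate.map f :=
    (f.map_adjugate _).symm
  change _ = f (numerator A B C)
  rw [zeroPolynomial, numerator, RingHom.map_dotProduct, h, hc, hc, ha]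
  congr 1
  ext i
  exact (RingHom.map_mulVec f _ _ i).symm

theorem IsObservable.eq_zero {A : Matrix (Fin n) (Fin n) ℝ} {C : Fin n → ℝ}
    (h : IsObservable A C) {u : Fin n → ℝ} (hu : ∀ k : ℕ, C ⬝ᵥ (A ^ k *ᵥ u) = 0) : u = 0 := by
  set O := Matrix.of fun k : Fin n => C ᵥ* A ^ (k : ℕ) with hO
  have hr : Module.finrank ℝ (LinearMap.range O.mulVecLin) = n := h
  have hk := LinearMap.finrank_range_add_finrank_ker O.mulVecLin
  rw [hr, Module.finrank_fin_fun] at hk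
  have hker : LinearMap.ker O.mulVecLin = ⊥ := by
    rw [← Submodule.finrank_eq_zero (R := ℝ)]
    omega
  have hmem : u ∈ LinearMap.ker O.mulVecLin := by
    rw [LinearMap.mem_ker, mulVecLin_apply]
    ext k
    simpa [hO, mulVec, dotProduct_mulVec] using hu k
  simpa [hker] using hmem

/-- A vanishing numerator gives Cᵀu = 0 by its top coefficient; then `numerator_mulVec` shows that
the numerator of Au vanishes too. By induction CᵀAᵏu = 0 for all k. -/
theorem IsObservable.numerator_injective {A : Matrix (Fin n) (Fin n) ℝ} {C : Fin n → ℝ}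
    (h : IsObservable A C) {u : Fin n → ℝ} (hu : numerator A u C = 0) : u = 0 := by
  rcases isEmpty_or_nonempty (Fin n) with hn | hn
  · exact Subsingleton.elim _ _
  have key (w : Fin n → ℝ) (hw : numerator A w C = 0) : C ⬝ᵥ w = 0 := by
    rw [← numerator_coeff A, hw, Polynomial.coeff_zero]
  have hk (k : ℕ) : numerator A (A ^ k *ᵥ u) C = 0 := by
    induction k with
    | zero => simpa using hu
    | succ k ih =>
      rw [pow_succ', ← Matrix.mulVec_mulVec, numerator_mulVec, ih, key _ ih]
      simp
  exact h.eq_zero fun k => key _ (hk k)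

/-- Pole placement by output injection. -/
theorem IsObservable.exists_charpoly_eq {A : Matrix (Fin n) (Fin n) ℝ} {C : Fin n → ℝ}
    (h : IsObservable A C) {p : Polynomial ℝ} (hp : p.Monic) (hn : p.degree = n) :
    ∃ l : Fin n → ℝ, (A + vecMulVec l C).charpoly = p := by
  let Φ : (Fin n → ℝ) →ₗ[ℝ] Polynomial.degreeLT ℝ n :=
    { toFun := fun l => ⟨numerator A l C, Polynomial.mem_degreeLT.2 (by
        simpa using numerator_degree_lt A l C)⟩
      map_add' := fun u u' => Subtype.ext (numerator_add_left A u u' C)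
      map_smul' := fun c u => Subtype.ext (by
        simp [numerator_smul_left, Polynomial.smul_eq_C_mul]) }
  have hinj : Function.Injective Φ := by
    rw [injective_iff_map_eq_zero]
    exact fun u hu => h.numerator_injective (congrArg Subtype.val hu)
  have hfin : Module.finrank ℝ (Fin n → ℝ) = Module.finrank ℝ (Polynomial.degreeLT ℝ n) :=
    (LinearEquiv.finrank_eq (Polynomial.degreeLTEquiv ℝ n)).symm
  have : FiniteDimensional ℝ (Polynomial.degreeLT ℝ n) :=
    Module.Finite.equiv (Polynomial.degreeLTEquiv ℝ n).symm
  have hd : (A.charpoly - p).degree < n := by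
    have hA : A.charpoly.degree = n := by simp [A.charpoly_degree_eq_dim]
    rw [← hA]
    exact Polynomial.degree_sub_lt_left (hA.trans hn.symm) A.charpoly_monic.ne_zero
      (by rw [A.charpoly_monic.leadingCoeff, hp.leadingCoeff])
  -- Both spaces have dimension n, so injectivity gives surjectivity.
  obtain ⟨l, hl⟩ := (LinearMap.injective_iff_surjective_of_finrank_eq_finrank hfin).1 hinj
    ⟨A.charpoly - p, Polynomial.mem_degreeLT.2 hd⟩
  have hl' : numerator A l C = A.charpoly - p := congrArg Subtype.val hl
  exact ⟨l, by rw [charpoly_add_vecMulVec, hl']; ring⟩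

end AdaptiveSISO

namespace AdaptiveSISO

variable {n : ℕ}

theorem dotProduct_sq_le (u v : Fin n → ℝ) : (u ⬝ᵥ v) ^ 2 ≤ (u ⬝ᵥ u) * (v ⬝ᵥ v) := by
  have := Finset.sum_mul_sq_le_sq_mul_sq Finset.univ u v
  simpa [dotProduct, pow_two] using this

theorem real_dotProduct_self_nonneg (u : Fin n → ℝ) : 0 ≤ u ⬝ᵥ u :=
  Finset.sum_nonneg fun i _ => mul_self_nonneg (u i)

theorem posDef_of_dotProduct {P : Matrix (Fin n) (Fin n) ℝ} (hP : Pᵀ = P)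
    (h : ∀ x, x ≠ 0 → 0 < x ⬝ᵥ (P *ᵥ x)) : P.PosDef := by
  refine Matrix.PosDef.of_dotProduct_mulVec_pos ?_ fun x hx => by simpa using h x hx
  rw [Matrix.IsHermitian, conjTranspose_eq_transpose_of_trivial, hP]

theorem PosDef.transpose_eq {P : Matrix (Fin n) (Fin n) ℝ} (hP : P.PosDef) : Pᵀ = P := by
  rw [← conjTranspose_eq_transpose_of_trivial]
  exact hP.isHermitian

theorem dotProduct_mulVec_comm {P : Matrix (Fin n) (Fin n) ℝ} (hP : Pᵀ = P) (u v : Fin n → ℝ) :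
    u ⬝ᵥ (P *ᵥ v) = v ⬝ᵥ (P *ᵥ u) := by
  rw [dotProduct_mulVec, ← mulVec_transpose, hP, dotProduct_comm]

theorem dotProduct_transpose_mulVec (A : Matrix (Fin n) (Fin n) ℝ) (u v : Fin n → ℝ) :
    u ⬝ᵥ (Aᵀ *ᵥ v) = v ⬝ᵥ (A *ᵥ u) := by
  rw [mulVec_transpose, dotProduct_comm, dotProduct_mulVec]

/-! ### Quadratic Lyapunov functions of Hurwitz matrices -/

section Hurwitz

open scoped Matrix.Norms.L2Operator ENNReal

/-- A matrix whose complex spectral radius is less than one has a power that is a strict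
contraction of the Euclidean norm. -/
theorem exists_pow_norm_lt_one {S : Matrix (Fin n) (Fin n) ℂ} (hS : spectralRadius ℂ S < 1) :
    ∃ k : ℕ, 0 < k ∧ ‖S ^ k‖ < 1 := by
  have h := spectrum.pow_nnnorm_pow_one_div_tendsto_nhds_spectralRadius S
  obtain ⟨k, hk, hk0⟩ := ((h.eventually_lt_const hS).and (eventually_gt_atTop 0)).exists
  refine ⟨k, hk0, ?_⟩
  have h1 : (‖S ^ k‖₊ : ℝ≥0∞) < 1 := by
    by_contra hc
    exact absurd (ENNReal.one_le_rpow (not_lt.1 hc) (by positivity)) (not_le.2 hk)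
  exact_mod_cast h1

theorem dotProduct_mulVec_self_le (S : Matrix (Fin n) (Fin n) ℝ) (x : Fin n → ℝ) :
    (S *ᵥ x) ⬝ᵥ (S *ᵥ x) ≤ ‖S.map (fun a : ℝ => (a : ℂ))‖ ^ 2 * (x ⬝ᵥ x) := by
  have h := Matrix.l2_opNorm_mulVec (S.map (fun a : ℝ => (a : ℂ)))
    (WithLp.toLp 2 (fun i => (x i : ℂ)))
  have hx (w : Fin n → ℝ) : ‖WithLp.toLp 2 (fun i => (w i : ℂ))‖ ^ 2 = w ⬝ᵥ w := by
    rw [EuclideanSpace.norm_sq_eq]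
    simp [dotProduct, pow_two]
  have hm : (S.map (fun a : ℝ => (a : ℂ))) *ᵥ (fun i => (x i : ℂ)) = fun i => ((S *ᵥ x) i : ℂ) := by
    ext i
    exact (RingHom.map_mulVec Complex.ofRealHom S x i).symm
  rw [← hx, ← hx, ← mul_pow]
  refine pow_le_pow_left₀ (norm_nonneg _) ?_ 2
  simpa [hm] using h

/-- |1 + hs|² = 1 + h(2 Re s + h|s|²) is below 1 for small h > 0, and there are only finitely many
eigenvalues s. -/
theorem IsHurwitz.exists_step {G : Matrix (Fin n) (Fin n) ℝ} (hG : IsHurwitz G) :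
    ∃ h : ℝ, 0 < h ∧ ∀ s : ℂ, (resolventMatrix G s).det = 0 → ‖1 + h * s‖ < 1 := by
  have hfin : {s : ℂ | (resolventMatrix G s).det = 0}.Finite := by
    refine (G.charpoly.rootSet_finite ℂ).subset fun s hs => ?_
    rw [Polynomial.mem_rootSet]
    exact ⟨G.charpoly_monic.ne_zero, by rw [← det_resolventMatrix]; exact hs⟩
  have hev : ∀ s ∈ {s : ℂ | (resolventMatrix G s).det = 0},
      ∀ᶠ h : ℝ in 𝓝[>] 0, ‖1 + h * s‖ < 1 := by
    intro s hs
    have hre : s.re < 0 := hG s hs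
    have ht : Tendsto (fun h : ℝ => 2 * s.re + h * Complex.normSq s) (𝓝[>] 0) (𝓝 (2 * s.re)) := by
      have : Continuous (fun h : ℝ => 2 * s.re + h * Complex.normSq s) := by fun_prop
      simpa using (this.tendsto 0).mono_left nhdsWithin_le_nhds
    filter_upwards [ht.eventually_lt_const (by linarith : 2 * s.re < 0), self_mem_nhdsWithin]
      with h hh hpos
    have hpos' : (0 : ℝ) < h := hpos
    have : ‖1 + h * s‖ ^ 2 < 1 := by
      rw [← Complex.normSq_eq_norm_sq, Complex.normSq_apply]
      rw [Complex.normSq_apply] at hh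
      simp only [Complex.add_re, Complex.one_re, Complex.mul_re, Complex.ofReal_re,
        Complex.ofReal_im, Complex.add_im, Complex.one_im, Complex.mul_im]
      nlinarith [mul_pos_of_neg_of_neg hh (neg_lt_zero.2 hpos')]
    nlinarith [norm_nonneg (1 + h * s)]
  obtain ⟨h, h1, h2⟩ := (((eventually_all_finite hfin).2 hev).and self_mem_nhdsWithin).exists
  exact ⟨h, h2, h1⟩

/-- Every Hurwitz matrix has a quadratic Lyapunov function. -/
theorem IsHurwitz.exists_lyapunov [NeZero n] {G : Matrix (Fin n) (Fin n) ℝ} (hG : IsHurwitz G) :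
    ∃ P : Matrix (Fin n) (Fin n) ℝ, P.PosDef ∧ ∃ c : ℝ, 0 < c ∧
      ∀ x, x ⬝ᵥ (P *ᵥ (G *ᵥ x)) ≤ -(c * (x ⬝ᵥ x)) := by
  obtain ⟨h, hpos, hs⟩ := hG.exists_step
  -- An explicit Euler step, with eigenvalues 1 + hs inside the unit disc.
  set S : Matrix (Fin n) (Fin n) ℝ := 1 + h • G with hS
  set f : Matrix (Fin n) (Fin n) ℝ →+* Matrix (Fin n) (Fin n) ℂ := Complex.ofRealHom.mapMatrix
    with hf
  have hrad : spectralRadius ℂ (f S) < 1 := by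
    refine spectrum.spectralRadius_lt_of_forall_lt (f S) (r := 1) fun z hz => ?_
    have hh : (h : ℂ) ≠ 0 := by exact_mod_cast hpos.ne'
    have hdet : (resolventMatrix G ((z - 1) / h)).det = 0 := by
      by_contra hne
      apply hz
      rw [spectrum.mem_resolventSet_iff, Matrix.isUnit_iff_isUnit_det]
      have : algebraMap ℂ (Matrix (Fin n) (Fin n) ℂ) z - f S =
          (h : ℂ) • resolventMatrix G ((z - 1) / h) := by
        ext i j
        by_cases hij : i = j
        · subst hij
          simp [hf, hS, resolventMatrix, Matrix.algebraMap_matrix_apply]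
          field_simp
          ring
        · simp [hf, hS, resolventMatrix, Matrix.algebraMap_matrix_apply, hij]
      rw [this, det_smul]
      exact isUnit_iff_ne_zero.2 (mul_ne_zero (pow_ne_zero _ hh) hne)
    have h1 := hs _ hdet
    rw [mul_div_cancel₀ _ hh, add_sub_cancel] at h1
    exact_mod_cast h1
  obtain ⟨k, hk, hk1⟩ := exists_pow_norm_lt_one hrad
  -- A truncated discrete Lyapunov series: its change under S telescopes to |Sᵏx|² - |x|², which is
  -- negative for x ≠ 0 since Sᵏ is a contraction.
  set P : Matrix (Fin n) (Fin n) ℝ := ∑ j ∈ Finset.range k, (S ^ j)ᵀ * S ^ j with hP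
  have hPq (x y : Fin n → ℝ) : x ⬝ᵥ (P *ᵥ y) =
      ∑ j ∈ Finset.range k, (S ^ j *ᵥ x) ⬝ᵥ (S ^ j *ᵥ y) := by
    rw [hP, Matrix.sum_mulVec, dotProduct_sum]
    refine Finset.sum_congr rfl fun j _ => ?_
    rw [← Matrix.mulVec_mulVec, dotProduct_transpose_mulVec, dotProduct_comm]
  have hPT : Pᵀ = P := by simp [hP, Matrix.transpose_sum, Matrix.transpose_mul]
  have hPpos (x : Fin n → ℝ) : x ⬝ᵥ x ≤ x ⬝ᵥ (P *ᵥ x) := by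
    rw [hPq]
    have := Finset.single_le_sum (f := fun j => (S ^ j *ᵥ x) ⬝ᵥ (S ^ j *ᵥ x))
      (fun j _ => real_dotProduct_self_nonneg _) (Finset.mem_range.2 hk)
    simpa using this
  refine ⟨P, posDef_of_dotProduct hPT fun x hx => ?_, (1 - ‖f (S ^ k)‖ ^ 2) / (2 * h), ?_, ?_⟩
  · exact lt_of_lt_of_le (lt_of_le_of_ne (real_dotProduct_self_nonneg x)
      (Ne.symm (by simpa using hx))) (hPpos x)
  · have h0 := norm_nonneg (f (S ^ k))
    rw [map_pow] at h0 ⊢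
    have : ‖f S ^ k‖ ^ 2 < 1 := by nlinarith
    exact div_pos (by linarith) (by linarith)
  · intro x
    have hstep : (S *ᵥ x) ⬝ᵥ (P *ᵥ (S *ᵥ x)) - x ⬝ᵥ (P *ᵥ x) =
        (S ^ k *ᵥ x) ⬝ᵥ (S ^ k *ᵥ x) - x ⬝ᵥ x := by
      rw [hPq, hPq, ← Finset.sum_sub_distrib]
      have := Finset.sum_range_sub (fun j => (S ^ j *ᵥ x) ⬝ᵥ (S ^ j *ᵥ x)) k
      simpa [pow_succ] using this
    have hSx : S *ᵥ x = x + h • (G *ᵥ x) := by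
      rw [hS, Matrix.add_mulVec, one_mulVec, Matrix.smul_mulVec]
    have hle : (S ^ k *ᵥ x) ⬝ᵥ (S ^ k *ᵥ x) ≤ ‖f (S ^ k)‖ ^ 2 * (x ⬝ᵥ x) :=
      dotProduct_mulVec_self_le _ x
    have hexp : (S *ᵥ x) ⬝ᵥ (P *ᵥ (S *ᵥ x)) = x ⬝ᵥ (P *ᵥ x) + 2 * h * (x ⬝ᵥ (P *ᵥ (G *ᵥ x))) +
        h ^ 2 * ((G *ᵥ x) ⬝ᵥ (P *ᵥ (G *ᵥ x))) := by
      rw [hSx]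
      simp only [Matrix.mulVec_add, Matrix.mulVec_smul, dotProduct_add, add_dotProduct,
        dotProduct_smul, smul_dotProduct, smul_eq_mul]
      rw [dotProduct_mulVec_comm hPT (G *ᵥ x) x]
      ring
    -- The second-order term of the Euler step has the sign that allows it to be dropped; division
    -- by 2h passes from S to G.
    have hnn : 0 ≤ h ^ 2 * ((G *ᵥ x) ⬝ᵥ (P *ᵥ (G *ᵥ x))) :=
      mul_nonneg (sq_nonneg h) ((real_dotProduct_self_nonneg _).trans (hPpos _))
    rw [div_mul_eq_mul_div, ← neg_div, le_div_iff₀ (by linarith)]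
    linarith

end Hurwitz

/-! ### Zero cancellation and the Lyapunov pair -/

variable {Am : Matrix (Fin n) (Fin n) ℝ} {B C : Fin n → ℝ} {σ : ℝ}

open Polynomial in
theorem exists_placesSinglePole (h1 : C ⬝ᵥ B ≠ 0) (h2 : IsObservable Am C) (σ : ℝ) :
    ∃ Ls : Fin n → ℝ, PlacesSinglePole Am B C Ls σ := by
  have hn : Nonempty (Fin n) := by
    by_contra hc
    rw [not_nonempty_iff] at hc
    exact h1 (by simp [dotProduct])
  have hn0 : 0 < n := Fin.pos_iff_nonempty.2 hn
  set N := numerator Am B C with hN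
  have hcoeff : N.coeff (n - 1) = C ⬝ᵥ B := by simpa using numerator_coeff Am B C
  have hN0 : N ≠ 0 := by
    rintro h
    rw [h, coeff_zero] at hcoeff
    exact h1 hcoeff.symm
  have hlt : N.natDegree < n := by
    rw [natDegree_lt_iff_degree_lt hN0]
    simpa using numerator_degree_lt Am B C
  have hdeg : N.natDegree = n - 1 :=
    natDegree_eq_of_le_of_coeff_ne_zero (by omega) (by rw [hcoeff]; exact h1)
  have hlead : N.leadingCoeff = C ⬝ᵥ B := by rw [leadingCoeff, hdeg, hcoeff]
  -- The target characteristic polynomial contains every zero of N, so only the pole -σ survives. As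
  -- N has degree n - 1 and leading coefficient CᵀB, p is monic of degree n.
  set p := Polynomial.C (C ⬝ᵥ B)⁻¹ * N * (X + Polynomial.C σ) with hp
  have hmon : p.Monic := by
    rw [Monic, hp, leadingCoeff_mul, leadingCoeff_mul, hlead, leadingCoeff_C, leadingCoeff_X_add_C,
      inv_mul_cancel₀ h1, mul_one]
  have hpn : p.natDegree = n := by
    rw [hp, natDegree_mul (mul_ne_zero (by simpa using h1) hN0) (X_add_C_ne_zero σ),
      natDegree_C_mul (inv_ne_zero h1), natDegree_X_add_C, hdeg]
    omega
  obtain ⟨l, hl⟩ := h2.exists_charpoly_eq hmon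
    (by rw [degree_eq_natDegree hmon.ne_zero, hpn])
  refine ⟨l, fun s hs hsσ => ?_⟩
  have hz := zeroPolynomial_eq _ B C s hs
  rw [zeroPolynomial_eq_aeval, numerator_outputInjection] at hz
  have hdet : (resolventMatrix (Am + vecMulVec l C) s).det =
      ((C ⬝ᵥ B : ℝ) : ℂ)⁻¹ * aeval s N * (s + σ) := by
    rw [det_resolventMatrix, hl, hp]
    simp
  have hsσ' : s + σ ≠ 0 := fun h => hsσ (eq_neg_of_add_eq_zero_left h)
  have hM : ((C ⬝ᵥ B : ℝ) : ℂ) ≠ 0 := by exact_mod_cast h1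
  rw [eq_div_iff hsσ']
  have hNs : aeval s N ≠ 0 := by
    intro h
    rw [h] at hdet
    simp at hdet
    exact hs hdet
  rw [hdet] at hz
  apply mul_left_cancel₀ (mul_ne_zero (inv_ne_zero hM) hNs)
  rw [inv_mul_eq_div, div_mul_cancel₀ _ hM]
  linear_combination -hz

open Polynomial in
theorem PlacesSinglePole.numerator_mul {Ls : Fin n → ℝ} (h : PlacesSinglePole Am B C Ls σ) :
    numerator Am B C * (X + Polynomial.C σ) =
      Polynomial.C (C ⬝ᵥ B) * (Am + vecMulVec Ls C).charpoly := by
  set χ := (Am + vecMulVec Ls C).charpoly with hχ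
  -- The hypothesis speaks only off the poles; the extra factor vanishes at the excluded points, so
  -- the product vanishes at every real s.
  have key : (numerator Am B C * (X + Polynomial.C σ) - Polynomial.C (C ⬝ᵥ B) * χ) *
      (χ * (X + Polynomial.C σ)) = 0 := by
    refine Polynomial.funext fun s => ?_
    by_cases h1 : χ.eval s = 0
    · simp [h1]
    by_cases h2 : s + σ = 0
    · simp [h2]
    have hdet : (resolventMatrix (Am + vecMulVec Ls C) (s : ℂ)).det = ((χ.eval s : ℝ) : ℂ) := by
      rw [det_resolventMatrix, ← Complex.coe_algebraMap, aeval_algebraMap_apply, coe_aeval_eq_eval]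
    have hdet0 : (resolventMatrix (Am + vecMulVec Ls C) (s : ℂ)).det ≠ 0 := by
      rw [hdet]; exact_mod_cast h1
    have hsσ : (s : ℂ) + σ ≠ 0 := by exact_mod_cast h2
    have hz := zeroPolynomial_eq _ B C s hdet0
    rw [h s hdet0 (fun h' => hsσ (by rw [h']; ring)), zeroPolynomial_eq_aeval,
      numerator_outputInjection, hdet, ← Complex.coe_algebraMap, aeval_algebraMap_apply,
      coe_aeval_eq_eval, Complex.coe_algebraMap, mul_div_assoc', eq_div_iff hsσ] at hz
    have hz' : (numerator Am B C).eval s * (s + σ) = χ.eval s * (C ⬝ᵥ B) := by exact_mod_cast hz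
    simp only [eval_mul, eval_sub, eval_add, eval_X, eval_C, eval_zero, hz']
    ring
  rcases mul_eq_zero.1 key with h0 | h0
  · exact sub_eq_zero.1 h0
  · rcases mul_eq_zero.1 h0 with h0 | h0
    · exact absurd h0 (charpoly_monic _).ne_zero
    · exact absurd h0 (X_add_C_ne_zero σ)

/-- By `numerator_mulVec` the cancellation identity says that FB + σB has numerator zero;
observability then makes this vector zero. -/
theorem PlacesSinglePole.mulVec_eq {Ls : Fin n → ℝ} (h2 : IsObservable Am C)
    (h : PlacesSinglePole Am B C Ls σ) :
    (Am + vecMulVec Ls C) *ᵥ B = -(σ • B) := by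
  set F := Am + vecMulVec Ls C with hF
  have h0 : numerator Am (F *ᵥ B + σ • B) C = 0 := by
    rw [← numerator_outputInjection Am Ls, ← hF, numerator_add_left, numerator_mulVec,
      numerator_smul_left, hF, numerator_outputInjection]
    linear_combination h.numerator_mul
  exact eq_neg_of_add_eq_zero_left (h2.numerator_injective h0)

open Polynomial in
theorem charpoly_add_vecMulVec_of_eigenvector {F : Matrix (Fin n) (Fin n) ℝ} {h : Fin n → ℝ}
    (hB : F *ᵥ B = -(σ • B)) (hh : h ⬝ᵥ B = 0) : (F + vecMulVec B h).charpoly = F.charpoly := by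
  have h0 := numerator_mulVec F B h
  rw [hB, hh, ← neg_smul, numerator_smul_left, Polynomial.C_0, zero_mul, sub_zero] at h0
  have h1 : (X + Polynomial.C σ) * numerator F B h = 0 := by
    rw [Polynomial.C_neg] at h0
    linear_combination -h0
  rw [charpoly_add_vecMulVec, (mul_eq_zero.1 h1).resolve_left (X_add_C_ne_zero σ), sub_zero]

theorem exists_isLyapunovPair {Ls : Fin n → ℝ} (h1 : C ⬝ᵥ B ≠ 0) (h2 : IsObservable Am C)
    (h3 : ∀ s : ℂ, Polynomial.aeval s (numerator Am B C) = 0 → s.re < 0) (hσ : 0 < σ)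
    (h : PlacesSinglePole Am B C Ls σ) :
    ∃ P Qs : Matrix (Fin n) (Fin n) ℝ, IsLyapunovPair Am B C Ls P Qs := by
  have hn : NeZero n := ⟨by rintro rfl; exact h1 (by simp [dotProduct])⟩
  have hFB := h.mulVec_eq h2
  have hnum := h.numerator_mul
  set F := Am + vecMulVec Ls C with hF
  set M := C ⬝ᵥ B with hM
  set g := Fᵀ *ᵥ C with hg
  have hgx (x : Fin n → ℝ) : g ⬝ᵥ x = C ⬝ᵥ (F *ᵥ x) := by
    rw [hg, dotProduct_comm, dotProduct_transpose_mulVec]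
  -- On ker Cᵀ, adding B wᵀ to F removes the B-component of Fz, so G preserves ker Cᵀ. Also wᵀB = 0,
  -- so the characteristic polynomial of F is kept.
  set w : Fin n → ℝ := -(M⁻¹ • (g + σ • C)) with hw
  have hwx (x : Fin n → ℝ) : w ⬝ᵥ x = -(M⁻¹ * (C ⬝ᵥ (F *ᵥ x) + σ * (C ⬝ᵥ x))) := by
    rw [hw, neg_dotProduct, smul_dotProduct, add_dotProduct, smul_dotProduct, hgx, smul_eq_mul,
      smul_eq_mul]
  have hwB : w ⬝ᵥ B = 0 := by
    rw [hwx, hFB, dotProduct_neg, dotProduct_smul, smul_eq_mul]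
    ring
  set G := F + vecMulVec B w with hG
  have hGH : IsHurwitz G := by
    intro s hs
    rw [det_resolventMatrix, hG, charpoly_add_vecMulVec_of_eigenvector hFB hwB] at hs
    have := congrArg (Polynomial.aeval s) hnum
    rw [map_mul, map_mul, hs, mul_zero] at this
    rcases mul_eq_zero.1 this with h0 | h0
    · exact h3 s h0
    · have h0' : s = -(σ : ℂ) := eq_neg_of_add_eq_zero_left (by simpa using h0)
      rw [h0']
      simpa using hσ
  obtain ⟨P0, hP0, c, hc, hdec⟩ := hGH.exists_lyapunov
  have hP0T := PosDef.transpose_eq hP0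
  -- The projection onto ker Cᵀ along B.
  set Z : Matrix (Fin n) (Fin n) ℝ := 1 - M⁻¹ • vecMulVec B C with hZ
  have hZx (x : Fin n → ℝ) : Z *ᵥ x = x - (M⁻¹ * (C ⬝ᵥ x)) • B := by
    rw [hZ, Matrix.sub_mulVec, one_mulVec, Matrix.smul_mulVec, vecMulVec_mulVec, op_smul_eq_smul,
      smul_smul]
  have hZB : Z *ᵥ B = 0 := by
    rw [hZx, ← hM, inv_mul_cancel₀ h1, one_smul, sub_self]
  have hZF (x : Fin n → ℝ) : Z *ᵥ (F *ᵥ x) = G *ᵥ (Z *ᵥ x) := by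
    have hCZ : C ⬝ᵥ (Z *ᵥ x) = 0 := by
      rw [hZx, dotProduct_sub, dotProduct_smul, smul_eq_mul, ← hM]
      field_simp
      ring
    rw [hG, Matrix.add_mulVec F, vecMulVec_mulVec, op_smul_eq_smul, hwx, hCZ, hZx, hZx,
      Matrix.mulVec_sub, Matrix.mulVec_smul, hFB, dotProduct_sub, dotProduct_smul, dotProduct_neg,
      dotProduct_smul, ← hM]
    ext i
    simp only [Pi.sub_apply, Pi.add_apply, Pi.smul_apply, Pi.neg_apply, smul_eq_mul]
    field_simp
    ring
  -- κc covers the Young bound for the cross term (Cᵀx)(gᵀz), with 1 to spare.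
  set κ := ((g ⬝ᵥ g) / (2 * σ) + 1) / c with hκ
  have hκ0 : 0 < κ := by
    have := real_dotProduct_self_nonneg g
    positivity
  set P : Matrix (Fin n) (Fin n) ℝ := vecMulVec C C + κ • (Zᵀ * P0 * Z) with hP
  have hPx (x y : Fin n → ℝ) : x ⬝ᵥ (P *ᵥ y) =
      (C ⬝ᵥ x) * (C ⬝ᵥ y) + κ * ((Z *ᵥ x) ⬝ᵥ (P0 *ᵥ (Z *ᵥ y))) := by
    rw [hP, Matrix.add_mulVec, vecMulVec_mulVec, op_smul_eq_smul, Matrix.smul_mulVec,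
      dotProduct_add, dotProduct_smul, dotProduct_smul, ← Matrix.mulVec_mulVec,
      ← Matrix.mulVec_mulVec, dotProduct_transpose_mulVec, smul_eq_mul, smul_eq_mul,
      dotProduct_comm x C, dotProduct_comm _ (Z *ᵥ x)]
    ring
  have hPT : Pᵀ = P := by
    rw [hP]
    simp [Matrix.transpose_add, Matrix.transpose_smul, Matrix.transpose_mul, hP0T, Matrix.mul_assoc,
      transpose_vecMulVec]
  have hcases (x : Fin n → ℝ) (hx : x ≠ 0) : C ⬝ᵥ x ≠ 0 ∨ Z *ᵥ x ≠ 0 := by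
    by_contra! hcon
    apply hx
    have := hZx x
    rw [hcon.1, hcon.2, mul_zero, zero_smul, sub_zero] at this
    exact this.symm
  have hPpos : P.PosDef := by
    refine posDef_of_dotProduct hPT fun x hx => ?_
    rw [hPx]
    have hz : 0 ≤ (Z *ᵥ x) ⬝ᵥ (P0 *ᵥ (Z *ᵥ x)) := by
      simpa using hP0.posSemidef.dotProduct_mulVec_nonneg (Z *ᵥ x)
    rcases hcases x hx with h0 | h0
    · have : 0 < (C ⬝ᵥ x) * (C ⬝ᵥ x) := mul_self_pos.2 h0
      positivity
    · have : 0 < (Z *ᵥ x) ⬝ᵥ (P0 *ᵥ (Z *ᵥ x)) := by simpa using hP0.dotProduct_mulVec_pos h0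
      have := mul_self_nonneg (C ⬝ᵥ x)
      positivity
  refine ⟨P, -(Fᵀ * P + P * F), hPpos, ?_, by rw [neg_neg], ?_⟩
  · refine posDef_of_dotProduct ?_ fun x hx => ?_
    · simp [Matrix.transpose_add, Matrix.transpose_mul, hPT, add_comm]
    have hq : x ⬝ᵥ (-(Fᵀ * P + P * F) *ᵥ x) = -(2 * (x ⬝ᵥ (P *ᵥ (F *ᵥ x)))) := by
      rw [Matrix.neg_mulVec, Matrix.add_mulVec, ← Matrix.mulVec_mulVec, ← Matrix.mulVec_mulVec,
        dotProduct_neg, dotProduct_add, dotProduct_transpose_mulVec, dotProduct_comm (P *ᵥ x),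
        dotProduct_mulVec_comm hPT (F *ᵥ x)]
      rw [dotProduct_mulVec_comm hPT x]
      ring
    rw [hq, hPx, hZF]
    set z := Z *ᵥ x with hz
    have hxz : x = z + (M⁻¹ * (C ⬝ᵥ x)) • B := by rw [hz, hZx]; simp
    have hCF : C ⬝ᵥ (F *ᵥ x) = g ⬝ᵥ z - σ * (C ⬝ᵥ x) := by
      conv_lhs => rw [hxz]
      rw [Matrix.mulVec_add, Matrix.mulVec_smul, hFB, hgx, dotProduct_add, dotProduct_smul,
        dotProduct_neg, dotProduct_smul, ← hM]
      simp only [smul_eq_mul]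
      field_simp
      ring
    rw [hCF]
    have hd := mul_le_mul_of_nonneg_left (hdec z) hκ0.le
    have hκc : κ * c = (g ⬝ᵥ g) / (2 * σ) + 1 := by rw [hκ]; field_simp
    have hcs : (g ⬝ᵥ z) ^ 2 / (2 * σ) ≤ (g ⬝ᵥ g) / (2 * σ) * (z ⬝ᵥ z) := by
      rw [div_mul_eq_mul_div]
      exact div_le_div_of_nonneg_right (dotProduct_sq_le g z) (by linarith)
    have hyoung : (C ⬝ᵥ x) * (g ⬝ᵥ z) ≤ σ / 2 * (C ⬝ᵥ x) ^ 2 + (g ⬝ᵥ z) ^ 2 / (2 * σ) := by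
      rw [← sub_nonneg]
      have : σ / 2 * (C ⬝ᵥ x) ^ 2 + (g ⬝ᵥ z) ^ 2 / (2 * σ) - (C ⬝ᵥ x) * (g ⬝ᵥ z) =
        (σ * (C ⬝ᵥ x) - g ⬝ᵥ z) ^ 2 / (2 * σ) := by
        field_simp
        ring
      rw [this]
      positivity
    have hpos : 0 < σ / 2 * (C ⬝ᵥ x) ^ 2 + z ⬝ᵥ z := by
      have hzz := real_dotProduct_self_nonneg z
      rcases hcases x hx with h0 | h0
      · have : 0 < (C ⬝ᵥ x) ^ 2 := by positivity
        positivity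
      · have : 0 < z ⬝ᵥ z := lt_of_le_of_ne hzz (Ne.symm (by simpa using h0))
        positivity
    have hexp : κ * -(c * (z ⬝ᵥ z)) = -((g ⬝ᵥ g) / (2 * σ) * (z ⬝ᵥ z)) - z ⬝ᵥ z := by
      linear_combination -(z ⬝ᵥ z) * hκc
    rw [hexp] at hd
    nlinarith
  · rw [hP, Matrix.add_mulVec, vecMulVec_mulVec, op_smul_eq_smul, Matrix.smul_mulVec,
      ← Matrix.mulVec_mulVec, hZB, Matrix.mulVec_zero, smul_zero, add_zero]

end AdaptiveSISO

namespace AdaptiveSISO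

/-! ### Calculus along integral curves of measurable fields -/

section Curves

variable {E : Type*} [NormedAddCommGroup E] [NormedSpace ℝ E] {X g : ℝ → E} {T K : ℝ}

theorem lipschitzOnWith_of_integral (hX : ∀ t ∈ Icc 0 T, X t = X 0 + ∫ s in (0 : ℝ)..t, g s)
    (hg : IntervalIntegrable g volume 0 T) (hK : ∀ t ∈ Icc 0 T, ‖g t‖ ≤ K) :
    LipschitzOnWith K.toNNReal X (Icc 0 T) := by
  have hint {t : ℝ} (ht : t ∈ Icc 0 T) : IntervalIntegrable g volume 0 t :=
    hg.mono_set (by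
      rw [uIcc_of_le ht.1, uIcc_of_le (ht.1.trans ht.2)]
      exact Icc_subset_Icc_right ht.2)
  refine LipschitzOnWith.of_dist_le_mul fun s hs t ht => ?_
  have hK0 : 0 ≤ K := (norm_nonneg _).trans (hK s hs)
  rw [Real.coe_toNNReal _ hK0, dist_eq_norm, hX s hs, hX t ht, add_sub_add_left_eq_sub,
    intervalIntegral.integral_interval_sub_left (hint hs) (hint ht), Real.dist_eq]
  refine intervalIntegral.norm_integral_le_of_norm_le_const fun u hu => hK u ?_
  have := uIoc_subset_uIcc hu
  rw [mem_uIcc] at this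
  rcases this with h | h
  · exact ⟨ht.1.trans h.1, h.2.trans hs.2⟩
  · exact ⟨hs.1.trans h.1, h.2.trans ht.2⟩

/-- The fundamental theorem of calculus for a `C¹` function along an integral curve of a bounded
measurable field. -/
theorem integral_of_contDiff_comp [FiniteDimensional ℝ E] (hT : 0 ≤ T)
    (hX : ∀ t ∈ Icc 0 T, X t = X 0 + ∫ s in (0 : ℝ)..t, g s)
    (hg : IntervalIntegrable g volume 0 T) (hK : ∀ t ∈ Icc 0 T, ‖g t‖ ≤ K)
    {φ : E → ℝ} (hφ : ContDiff ℝ 1 φ) {ψ : ℝ → ℝ}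
    (hψ : ∀ t, HasDerivAt X (g t) t → HasDerivAt (fun s => φ (X s)) (ψ t) t) :
    IntervalIntegrable ψ volume 0 T ∧
      ∀ s ∈ Icc 0 T, ∀ t ∈ Icc 0 T, φ (X t) - φ (X s) = ∫ u in s..t, ψ u := by
  -- X is Lipschitz and φ is Lipschitz on a ball containing its values, so φ ∘ X is absolutely
  -- continuous and its almost everywhere derivative integrates back to it.
  have hlip := lipschitzOnWith_of_integral hX hg hK
  obtain ⟨b, hb⟩ := isCompact_Icc.exists_bound_of_continuousOn hlip.continuousOn
  have : ProperSpace E := FiniteDimensional.proper ℝ E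
  obtain ⟨Kφ, hKφ⟩ := (hφ.contDiffOn (s := Metric.closedBall 0 b)).exists_lipschitzOnWith
    (by decide) (convex_closedBall _ _) (isCompact_closedBall _ _)
  have hf : LipschitzOnWith (Kφ * K.toNNReal) (fun s => φ (X s)) (Icc 0 T) :=
    hKφ.comp hlip fun t ht => by simpa using hb t ht
  have hac : AbsolutelyContinuousOnInterval (fun s => φ (X s)) 0 T :=
    LipschitzOnWith.absolutelyContinuousOnInterval (by rwa [uIcc_of_le hT])
  have hder : ∀ᵐ t, t ∈ Ioo 0 T → deriv (fun s => φ (X s)) t = ψ t := by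
    filter_upwards [hg.ae_hasDerivAt_integral] with t ht htT
    have h1 := ht (by rw [uIcc_of_le hT]; exact Ioo_subset_Icc_self htT) 0 left_mem_uIcc
    have h2 : HasDerivAt X (g t) t := by
      refine (h1.const_add (X 0)).congr_of_eventuallyEq ?_
      filter_upwards [Icc_mem_nhds htT.1 htT.2] with s hs using hX s hs
    exact (hψ t h2).deriv
  have hder' : ∀ᵐ t, t ∈ Ioc 0 T → deriv (fun s => φ (X s)) t = ψ t := by
    have hne : ∀ᵐ t : ℝ, t ≠ T := by simp [ae_iff, measure_singleton]
    filter_upwards [hder, hne] with t ht htT h using ht ⟨h.1, lt_of_le_of_ne h.2 htT⟩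
  refine ⟨hac.intervalIntegrable_deriv.congr_ae ?_, fun s hs t ht => ?_⟩
  · rw [uIoc_of_le hT]
    exact (ae_restrict_iff' measurableSet_Ioc).2 hder'
  · have hsub : uIcc s t ⊆ uIcc 0 T := by
      rw [uIcc_of_le hT]
      exact ordConnected_Icc.uIcc_subset hs ht
    rw [← (hac.mono hsub).integral_deriv_eq_sub]
    refine intervalIntegral.integral_congr_ae ?_
    filter_upwards [hder'] with u hu hust
    refine hu ⟨lt_of_le_of_lt (le_min hs.1 ht.1) hust.1, hust.2.trans (max_le hs.2 ht.2)⟩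

end Curves

/-- A function that decreases whenever it exceeds a level stays below that level. -/
theorem le_of_integral_nonpos_above {f ψ : ℝ → ℝ} {T k : ℝ} (hf : ContinuousOn f (Icc 0 T))
    (hψ : ∀ s ∈ Icc 0 T, ∀ t ∈ Icc 0 T, f t - f s = ∫ u in s..t, ψ u) (h0 : f 0 ≤ k)
    (hdec : ∀ t ∈ Icc 0 T, k < f t → ψ t ≤ 0) {t : ℝ} (ht : t ∈ Icc 0 T) : f t ≤ k := by
  by_contra! hlt
  -- Its supremum is the last time before t with f ≤ k; after it ψ ≤ 0, so f cannot rise.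
  set A : Set ℝ := Icc 0 t ∩ f ⁻¹' Iic k with hA
  have hcl : IsCompact A := by
    refine IsCompact.of_isClosed_subset isCompact_Icc ?_ inter_subset_left
    exact (hf.mono (Icc_subset_Icc_right ht.2)).preimage_isClosed_of_isClosed isClosed_Icc
      isClosed_Iic
  have hne : A.Nonempty := ⟨0, ⟨le_refl _, ht.1⟩, h0⟩
  have hmem := hcl.sSup_mem hne
  set s := sSup A with hs
  have hst : s ≤ t := hmem.1.2
  have hsT : s ∈ Icc 0 T := ⟨hmem.1.1, hst.trans ht.2⟩
  have habove : ∀ u ∈ Ioc s t, ψ u ≤ 0 := by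
    intro u hu
    have huT : u ∈ Icc 0 T := ⟨hsT.1.trans hu.1.le, hu.2.trans ht.2⟩
    refine hdec u huT ?_
    by_contra! hle
    exact absurd (le_csSup hcl.bddAbove (⟨⟨huT.1, hu.2⟩, hle⟩ : u ∈ A)) (not_le.2 hu.1)
  have h1 := hψ s hsT t ht
  have h2 : ∫ u in s..t, ψ u ≤ 0 := by
    rw [intervalIntegral.integral_of_le hst]
    exact setIntegral_nonpos measurableSet_Ioc habove
  have h3 : f s ≤ k := hmem.2
  linarith

/-- A variant of Barbalat's lemma: a Lipschitz function whose square is dissipated by a nonnegative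
storage function tends to zero. -/
theorem tendsto_zero_of_dissipation {f W : ℝ → ℝ} {K : NNReal} {c : ℝ} (hc : 0 < c)
    (hf : LipschitzOnWith K f (Ici 0)) (hW0 : ∀ t, 0 ≤ t → 0 ≤ W t)
    (hW : ∀ s t, 0 ≤ s → s ≤ t → c * ∫ u in s..t, f u ^ 2 ≤ W s - W t) :
    Tendsto f atTop (𝓝 0) := by
  have hanti : Antitone fun t => W (max t 0) := by
    intro s t hst
    have h1 := hW (max s 0) (max t 0) (le_max_right _ _) (max_le_max hst le_rfl)
    have h2 : 0 ≤ ∫ u in (max s 0)..(max t 0), f u ^ 2 :=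
      intervalIntegral.integral_nonneg (max_le_max hst le_rfl) fun u _ => sq_nonneg _
    have := mul_nonneg hc.le h2
    simp only
    linarith
  have hlim := tendsto_atTop_ciInf hanti
    ⟨0, by rintro _ ⟨t, rfl⟩; exact hW0 _ (le_max_right _ _)⟩
  rw [Metric.tendsto_atTop]
  intro ε hε
  -- Within time δ, f changes by at most ε/2. So |f t| ≥ ε would cost W at least cδ(ε/2)² on [t, t +
  -- δ], while W converges. K + 1 avoids division by zero.
  set δ := ε / (2 * (K + 1)) with hδ
  have hδ0 : 0 < δ := by positivity
  have hdiff : Tendsto (fun t => W (max t 0) - W (max (t + δ) 0)) atTop (𝓝 0) := by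
    simpa using hlim.sub (hlim.comp (tendsto_atTop_add_const_right atTop δ tendsto_id))
  obtain ⟨N, hN⟩ := eventually_atTop.1 (hdiff.eventually_lt_const
    (show 0 < c * (δ * (ε / 2) ^ 2) by positivity))
  refine ⟨max N 0, fun t ht => ?_⟩
  have ht0 : 0 ≤ t := (le_max_right _ _).trans ht
  rw [Real.dist_eq, sub_zero]
  by_contra! hge
  have hlow : ∀ u ∈ Icc t (t + δ), (ε / 2) ^ 2 ≤ f u ^ 2 := by
    intro u hu
    have h1 := hf.dist_le_mul t ht0 u (ht0.trans hu.1)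
    rw [Real.dist_eq, Real.dist_eq, abs_sub_comm t u, abs_of_nonneg (by linarith [hu.1] : 0 ≤ u - t)]
      at h1
    have h2 : (K : ℝ) * (u - t) ≤ ε / 2 := by
      have h3 : u - t ≤ δ := by linarith [hu.2]
      have h4 : (K : ℝ) * (u - t) ≤ (K + 1) * δ := by
        have := K.coe_nonneg
        have h5 : 0 ≤ u - t := by linarith [hu.1]
        nlinarith
      have h6 : ((K : ℝ) + 1) * δ = ε / 2 := by
        rw [hδ]; field_simp
      linarith
    have h7 : ε / 2 ≤ |f u| := by
      have := abs_sub_abs_le_abs_sub (f t) (f u)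
      linarith
    rw [← sq_abs (f u)]
    exact pow_le_pow_left₀ (by positivity) h7 2
  have hcont : ContinuousOn (fun u => f u ^ 2) (Icc t (t + δ)) :=
    (hf.continuousOn.mono fun u hu => ht0.trans hu.1).pow 2
  have hint : δ * (ε / 2) ^ 2 ≤ ∫ u in t..(t + δ), f u ^ 2 := by
    have := intervalIntegral.integral_mono_on (μ := volume) (by linarith : t ≤ t + δ)
      intervalIntegrable_const
      (hcont.intervalIntegrable_of_Icc (by linarith : t ≤ t + δ)) hlow
    simpa using this
  have h1 := hN t ((le_max_left _ _).trans ht)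
  rw [max_eq_left ht0, max_eq_left (by linarith)] at h1
  have h2 := hW t (t + δ) ht0 (by linarith)
  have h3 := mul_le_mul_of_nonneg_left hint hc.le
  linarith

/-! ### Global Carathéodory solutions of Lipschitz equations -/

section Existence

variable {E : Type*} [NormedAddCommGroup E] [NormedSpace ℝ E]

theorem norm_integral_le_of_norm_le_exp {h : ℝ → E} {D l t : ℝ} (hl : 0 < l) (ht : 0 ≤ t)
    (hD : 0 ≤ D) (hh : ∀ s, 0 ≤ s → ‖h s‖ ≤ D * Real.exp (l * s)) :
    ‖∫ s in (0 : ℝ)..t, h s‖ ≤ D / l * Real.exp (l * t) := by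
  have h1 : ‖∫ s in (0 : ℝ)..t, h s‖ ≤ ∫ s in (0 : ℝ)..t, D * Real.exp (l * s) :=
    intervalIntegral.norm_integral_le_of_norm_le ht
      (Eventually.of_forall fun s hs => hh s hs.1.le)
      (Continuous.intervalIntegrable (by fun_prop) _ _)
  have h2 : ∫ s in (0 : ℝ)..t, D * Real.exp (l * s) = D / l * (Real.exp (l * t) - 1) := by
    rw [intervalIntegral.integral_const_mul,
      intervalIntegral.integral_comp_mul_left Real.exp hl.ne', integral_exp, mul_zero, Real.exp_zero,
      smul_eq_mul]
    ring
  rw [h2] at h1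
  have : 0 ≤ D / l := by positivity
  nlinarith

open BoundedContinuousFunction in
/-- Global Carathéodory solutions for a field that is Lipschitz in the state. -/
theorem exists_integral_curve [CompleteSpace E] {F : ℝ → E → E} {K : NNReal} {c : ℝ}
    (hF : ∀ t, LipschitzWith K (F t)) (hb : ∀ t, ‖F t 0‖ ≤ c)
    (hmeas : ∀ Y : ℝ → E, Continuous Y → StronglyMeasurable fun t => F t (Y t)) (x₀ : E) :
    ∃ X : ℝ → E, Continuous X ∧ ∀ t, 0 ≤ t → X t = x₀ + ∫ s in (0 : ℝ)..t, F s (X s) := by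
  have hc : 0 ≤ c := (norm_nonneg _).trans (hb 0)
  -- The exponential weight for Y = exp(-lt) X: the Picard map has Lipschitz constant K/l ≤ 1/2 on
  -- all of [0, ∞) at once. Times are clipped by max t 0 to work with functions on ℝ.
  set l : ℝ := 2 * K + 1 with hl
  have hl0 : 0 < l := by positivity
  have hgrow (t : ℝ) (x : E) : ‖F t x‖ ≤ c + K * ‖x‖ := by
    have h1 := (hF t).dist_le_mul x 0
    rw [dist_eq_norm, dist_zero_right] at h1
    have h2 := norm_add_le (F t x - F t 0) (F t 0)
    rw [sub_add_cancel] at h2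
    linarith [hb t]
  let h (Y : ℝ →ᵇ E) (s : ℝ) : E := F s (Real.exp (l * s) • Y s)
  have hcurve (Y : ℝ →ᵇ E) : Continuous fun s => Real.exp (l * s) • Y s := by
    have := Y.continuous
    fun_prop
  have hint (Y : ℝ →ᵇ E) (a b : ℝ) : IntervalIntegrable (h Y) volume a b := by
    refine IntervalIntegrable.mono_fun' (g := fun s => c + K * ‖Real.exp (l * s) • Y s‖) ?_
      (hmeas _ (hcurve Y)).aestronglyMeasurable (Eventually.of_forall fun s => hgrow s _)
    exact Continuous.intervalIntegrable (continuous_const.add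
      (continuous_const.mul (hcurve Y).norm)) _ _
  have hprim (Y : ℝ →ᵇ E) : Continuous fun t => ∫ s in (0 : ℝ)..(max t 0), h Y s :=
    (intervalIntegral.continuous_primitive (hint Y) 0).comp (continuous_id.max continuous_const)
  have hcancel (t : ℝ) : Real.exp (-(l * t)) * Real.exp (l * t) = 1 := by
    rw [← Real.exp_add]; simp
  have hbound (Y : ℝ →ᵇ E) (t : ℝ) :
      ‖Real.exp (-(l * max t 0)) • (x₀ + ∫ s in (0 : ℝ)..(max t 0), h Y s)‖ ≤
        ‖x₀‖ + (c + K * ‖Y‖) / l := by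
    have ht : 0 ≤ max t 0 := le_max_right _ _
    have h1 := norm_integral_le_of_norm_le_exp (h := h Y) (D := c + K * ‖Y‖) hl0 ht
      (by positivity) fun s hs => by
        refine (hgrow s _).trans ?_
        have he : 1 ≤ Real.exp (l * s) := Real.one_le_exp (by positivity)
        have h2 : ‖Real.exp (l * s) • Y s‖ ≤ Real.exp (l * s) * ‖Y‖ := by
          rw [norm_smul, Real.norm_eq_abs, abs_of_pos (Real.exp_pos _)]
          exact mul_le_mul_of_nonneg_left (Y.norm_coe_le_norm s) (Real.exp_pos _).le
        have h3 := mul_le_mul_of_nonneg_left h2 K.coe_nonneg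
        nlinarith
    have he1 : Real.exp (-(l * max t 0)) ≤ 1 := Real.exp_le_one_iff.2 (by
      have := mul_nonneg hl0.le ht
      linarith)
    rw [norm_smul, Real.norm_eq_abs, abs_of_pos (Real.exp_pos _)]
    refine (mul_le_mul_of_nonneg_left (norm_add_le _ _) (Real.exp_pos _).le).trans ?_
    rw [mul_add]
    refine add_le_add (mul_le_of_le_one_left (norm_nonneg _) he1) ?_
    refine (mul_le_mul_of_nonneg_left h1 (Real.exp_pos _).le).trans (le_of_eq ?_)
    rw [mul_left_comm, hcancel, mul_one]
  let Φ (Y : ℝ →ᵇ E) : ℝ →ᵇ E := BoundedContinuousFunction.ofNormedAddCommGroup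
    (fun t => Real.exp (-(l * max t 0)) • (x₀ + ∫ s in (0 : ℝ)..(max t 0), h Y s))
    (by
      have := hprim Y
      fun_prop) _ (hbound Y)
  have hcontr : ContractingWith (1 / 2) Φ := by
    refine ⟨by
      rw [← NNReal.coe_lt_coe]
      norm_num, LipschitzWith.of_dist_le_mul fun Y Z => ?_⟩
    refine (BoundedContinuousFunction.dist_le (by positivity)).2 fun t => ?_
    have ht : 0 ≤ max t 0 := le_max_right _ _
    change dist (Real.exp (-(l * max t 0)) • (x₀ + ∫ s in (0 : ℝ)..(max t 0), h Y s))
      (Real.exp (-(l * max t 0)) • (x₀ + ∫ s in (0 : ℝ)..(max t 0), h Z s)) ≤ _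
    rw [dist_eq_norm, ← smul_sub, add_sub_add_left_eq_sub,
      ← intervalIntegral.integral_sub (hint Y _ _) (hint Z _ _), norm_smul, Real.norm_eq_abs,
      abs_of_pos (Real.exp_pos _)]
    have h1 := norm_integral_le_of_norm_le_exp (h := fun s => h Y s - h Z s)
      (D := K * dist Y Z) hl0 ht (by positivity) fun s hs => by
        rw [← dist_eq_norm]
        refine ((hF s).dist_le_mul _ _).trans ?_
        rw [mul_assoc]
        refine mul_le_mul_of_nonneg_left ?_ K.coe_nonneg
        rw [dist_smul₀, Real.norm_eq_abs, abs_of_pos (Real.exp_pos _), mul_comm]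
        exact mul_le_mul_of_nonneg_right (BoundedContinuousFunction.dist_coe_le_dist s)
          (Real.exp_pos _).le
    refine (mul_le_mul_of_nonneg_left h1 (Real.exp_pos _).le).trans ?_
    rw [mul_left_comm, hcancel, mul_one, mul_div_right_comm]
    refine mul_le_mul_of_nonneg_right ?_ dist_nonneg
    rw [div_le_iff₀ hl0]
    have := K.coe_nonneg
    push_cast
    rw [hl]
    linarith
  obtain ⟨Y, hY⟩ : ∃ Y, Φ Y = Y := ⟨_, hcontr.fixedPoint_isFixedPt⟩
  refine ⟨fun s => Real.exp (l * s) • Y s, hcurve Y, fun t ht => ?_⟩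
  have h1 : Y t = Real.exp (-(l * max t 0)) • (x₀ + ∫ s in (0 : ℝ)..(max t 0), h Y s) :=
    (congrArg (fun Z : ℝ →ᵇ E => Z t) hY).symm
  rw [max_eq_left ht] at h1
  simp only
  rw [h1, smul_smul, mul_comm, hcancel, one_smul]

end Existence

end AdaptiveSISO

namespace AdaptiveSISO

variable {n : ℕ}

/-! ### Quadratic forms and the smallest eigenvalue -/

section QuadraticForms

theorem continuous_quadraticForm (P : Matrix (Fin n) (Fin n) ℝ) :
    Continuous fun x : Fin n → ℝ => x ⬝ᵥ (P *ᵥ x) := by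
  simp only [dotProduct, mulVec]
  fun_prop

theorem contDiff_quadraticForm (P : Matrix (Fin n) (Fin n) ℝ) :
    ContDiff ℝ 1 fun x : Fin n → ℝ => x ⬝ᵥ (P *ᵥ x) := by
  simp only [dotProduct, mulVec]
  fun_prop

theorem hasDerivAt_quadraticForm {P : Matrix (Fin n) (Fin n) ℝ} (hP : Pᵀ = P)
    {u : ℝ → Fin n → ℝ} {u' : Fin n → ℝ} {t : ℝ} (hu : HasDerivAt u u' t) :
    HasDerivAt (fun s => u s ⬝ᵥ (P *ᵥ u s)) (2 * (u t ⬝ᵥ (P *ᵥ u'))) t := by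
  have hc := hasDerivAt_pi.1 hu
  have hm (i : Fin n) : HasDerivAt (fun s => (P *ᵥ u s) i) ((P *ᵥ u') i) t := by
    simp only [mulVec, dotProduct]
    exact HasDerivAt.fun_sum fun j _ => (hc j).const_mul (P i j)
  have h : HasDerivAt (fun s => ∑ i, u s i * (P *ᵥ u s) i)
      (∑ i, (u' i * (P *ᵥ u t) i + u t i * (P *ᵥ u') i)) t :=
    HasDerivAt.fun_sum fun i _ => (hc i).mul (hm i)
  refine HasDerivAt.congr_deriv h ?_
  rw [Finset.sum_add_distrib, two_mul]
  congr 1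
  exact dotProduct_mulVec_comm hP _ _

/-- For n = 0 the spectrum is empty and `sInf` returns 0, hence `NeZero n`. -/
theorem PosDef.minEigenvalue_pos [NeZero n] {P : Matrix (Fin n) (Fin n) ℝ} (hP : P.PosDef) :
    0 < minEigenvalue P := by
  have hs := hP.isHermitian.spectrum_real_eq_range_eigenvalues
  have hmem : sInf (spectrum ℝ P) ∈ spectrum ℝ P := by
    rw [hs]
    exact (Set.finite_range _).isCompact.sInf_mem (Set.range_nonempty _)
  rw [hs] at hmem
  obtain ⟨i, hi⟩ := hmem
  rw [minEigenvalue, hs, ← hi]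
  exact hP.eigenvalues_pos i

theorem minEigenvalue_mul_le {P : Matrix (Fin n) (Fin n) ℝ} (hP : P.IsHermitian)
    (x : Fin n → ℝ) : minEigenvalue P * (x ⬝ᵥ x) ≤ x ⬝ᵥ (P *ᵥ x) := by
  have hs := hP.spectrum_real_eq_range_eigenvalues
  set m := minEigenvalue P with hm
  have hQ : (P - m • (1 : Matrix (Fin n) (Fin n) ℝ)).IsHermitian :=
    hP.sub (by simp [Matrix.IsHermitian])
  have hpsd : (P - m • (1 : Matrix (Fin n) (Fin n) ℝ)).PosSemidef := by
    rw [hQ.posSemidef_iff_eigenvalues_nonneg]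
    intro i
    have hi := hQ.eigenvalues_mem_spectrum_real i
    have h1 : hQ.eigenvalues i + m ∈ spectrum ℝ P := by
      have := (spectrum.add_mem_add_iff (R := ℝ) (a := P - m • (1 : Matrix (Fin n) (Fin n) ℝ))
        (r := hQ.eigenvalues i) (s := m)).2 hi
      rw [Algebra.algebraMap_eq_smul_one, add_comm (m • _), sub_add_cancel] at this
      exact this
    have h2 : m ≤ hQ.eigenvalues i + m :=
      csInf_le (by rw [hs]; exact (Set.finite_range _).bddBelow) h1
    simpa using h2
  have := hpsd.dotProduct_mulVec_nonneg x
  simpa [Matrix.sub_mulVec, Matrix.smul_mulVec, dotProduct_sub] using this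

theorem norm_le_of_dotProduct_le {x : Fin n → ℝ} {v : ℝ} (h : x ⬝ᵥ x ≤ v) : ‖x‖ ≤ √v := by
  refine (pi_norm_le_iff_of_nonneg (Real.sqrt_nonneg v)).2 fun i => ?_
  refine Real.abs_le_sqrt (le_trans ?_ h)
  rw [pow_two]
  exact Finset.single_le_sum (f := fun i => x i * x i) (fun j _ => mul_self_nonneg _)
    (Finset.mem_univ i)

theorem PosDef.norm_le [NeZero n] {P : Matrix (Fin n) (Fin n) ℝ} (hP : P.PosDef) {x : Fin n → ℝ}
    {v : ℝ} (h : x ⬝ᵥ (P *ᵥ x) ≤ v) : ‖x‖ ≤ √(v / minEigenvalue P) := by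
  refine norm_le_of_dotProduct_le ?_
  rw [le_div_iff₀ (PosDef.minEigenvalue_pos hP), mul_comm]
  exact (minEigenvalue_mul_le hP.isHermitian x).trans h

theorem PosDef.nonneg {P : Matrix (Fin n) (Fin n) ℝ} (hP : P.PosDef) (x : Fin n → ℝ) :
    0 ≤ x ⬝ᵥ (P *ᵥ x) := by
  simpa using hP.posSemidef.dotProduct_mulVec_nonneg x

end QuadraticForms

/-! ### Regularity of the closed-loop field along solutions -/

section Field

variable (S : Loop n)

theorem Loop.contDiff_field : ContDiff ℝ 1 fun p : ℝ × State n => S.field p.1 p.2 := by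
  have h : (fun p : ℝ × State n => S.field p.1 p.2) = fun p =>
      ((fun i => (∑ j, S.A i j * p.2.1 j) +
          (S.lam * ((∑ j, p.2.2.2.1 j * p.2.2.1 j) + p.2.2.2.2 * p.1)) * S.B i),
        (fun i => (∑ j, S.Am i j * p.2.2.1 j) + p.1 * S.B i -
          ((∑ j, S.C j * p.2.1 j) - ∑ j, S.C j * p.2.2.1 j) * S.L i),
        (fun i => -((((∑ j, S.C j * p.2.1 j) - ∑ j, S.C j * p.2.2.1 j) * S.M) *
          ∑ j, S.Γθ i j * p.2.2.1 j)),
        -(S.Γk * p.1 * ((∑ j, S.C j * p.2.1 j) - ∑ j, S.C j * p.2.2.1 j) * S.M)) := rfl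
  rw [h]
  fun_prop

variable {S} {r : ℝ → ℝ} {X : ℝ → State n} {I : Set ℝ} {T c : ℝ}

theorem Loop.exists_field_bound (S : Loop n) (c b : ℝ) :
    ∃ K : ℝ, ∀ ρ X, |ρ| ≤ c → ‖X‖ ≤ b → ‖S.field ρ X‖ ≤ K := by
  obtain ⟨K, hK⟩ := ((isCompact_Icc (a := -c) (b := c)).prod
    (isCompact_closedBall (0 : State n) b)).exists_bound_of_continuousOn
      S.contDiff_field.continuous.continuousOn
  exact ⟨K, fun ρ X hρ hX => hK (ρ, X) ⟨abs_le.1 hρ, by simpa using hX⟩⟩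

theorem Loop.IsSolutionOn.exists_bound (h : S.IsSolutionOn r X I) (hT : 0 ≤ T)
    (hI : Icc 0 T ⊆ I) (hr : Measurable r) (hc : ∀ t, 0 ≤ t → |r t| ≤ c) :
    IntervalIntegrable (fun t => S.field (r t) (X t)) volume 0 T ∧
      ∃ K, ∀ t ∈ Icc 0 T, ‖S.field (r t) (X t)‖ ≤ K := by
  have hcont : ContinuousOn X (Icc 0 T) := h.1.mono hI
  obtain ⟨b, hb⟩ := isCompact_Icc.exists_bound_of_continuousOn hcont
  obtain ⟨K, hK⟩ := S.exists_field_bound c b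
  have hK' : ∀ t ∈ Icc 0 T, ‖S.field (r t) (X t)‖ ≤ K := fun t ht => hK _ _ (hc t ht.1) (hb t ht)
  refine ⟨?_, K, hK'⟩
  rw [intervalIntegrable_iff_integrableOn_Icc_of_le hT]
  refine Integrable.mono' (g := fun _ => K) (integrableOn_const (by simp)) ?_
    ((ae_restrict_iff' measurableSet_Icc).2 (Eventually.of_forall hK'))
  exact S.contDiff_field.continuous.comp_aestronglyMeasurable
    (hr.stronglyMeasurable.aestronglyMeasurable.prodMk
      (hcont.aestronglyMeasurable measurableSet_Icc))

/-- The fundamental theorem of calculus for a `C¹` function along a solution. -/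
theorem Loop.IsSolutionOn.integral_comp (h : S.IsSolutionOn r X I) (hT : 0 ≤ T)
    (hI : Icc 0 T ⊆ I) (hr : Measurable r) (hc : ∀ t, 0 ≤ t → |r t| ≤ c)
    {φ : State n → ℝ} {φ' : State n → State n → ℝ} (hφ : ContDiff ℝ 1 φ)
    (hφ' : ∀ (Y : ℝ → State n) (v : State n) (t : ℝ), HasDerivAt Y v t →
      HasDerivAt (fun s => φ (Y s)) (φ' (Y t) v) t) :
    IntervalIntegrable (fun t => φ' (X t) (S.field (r t) (X t))) volume 0 T ∧
      ∀ s ∈ Icc 0 T, ∀ t ∈ Icc 0 T,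
        φ (X t) - φ (X s) = ∫ u in s..t, φ' (X u) (S.field (r u) (X u)) := by
  obtain ⟨hint, K, hK⟩ := h.exists_bound hT hI hr hc
  exact integral_of_contDiff_comp hT (fun t ht => h.2 t (hI ht)) hint hK hφ
    fun t ht => hφ' X _ t ht

/-- A level of a `C¹` function that the field does not cross upwards bounds the function along
every solution. -/
theorem Loop.IsSolutionOn.le_of_field (h : S.IsSolutionOn r X I) (hT : 0 ≤ T)
    (hI : Icc 0 T ⊆ I) (hr : Measurable r) (hc : ∀ t, 0 ≤ t → |r t| ≤ c)
    {φ : State n → ℝ} {φ' : State n → State n → ℝ} (hφ : ContDiff ℝ 1 φ)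
    (hφ' : ∀ (Y : ℝ → State n) (v : State n) (t : ℝ), HasDerivAt Y v t →
      HasDerivAt (fun s => φ (Y s)) (φ' (Y t) v) t) {k : ℝ} (h0 : φ (X 0) ≤ k)
    (hdec : ∀ t ∈ Icc 0 T, k < φ (X t) → φ' (X t) (S.field (r t) (X t)) ≤ 0) :
    φ (X T) ≤ k :=
  le_of_integral_nonpos_above (f := fun t => φ (X t))
    (hφ.continuous.comp_continuousOn (h.1.mono hI)) (h.integral_comp hT hI hr hc hφ hφ').2 h0 hdec
    ⟨hT, le_rfl⟩

end Field

/-! ### Global existence by truncation -/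

section Existence

/-- Coordinatewise truncation of the state. -/
def truncate (b : ℝ) (X : State n) : State n :=
  (fun i => max (-b) (min b (X.1 i)), fun i => max (-b) (min b (X.2.1 i)),
    fun i => max (-b) (min b (X.2.2.1 i)), max (-b) (min b X.2.2.2))

theorem truncate_lipschitz (b : ℝ) : LipschitzWith 1 (truncate b : State n → State n) := by
  have hr : LipschitzWith 1 fun x : ℝ => max (-b) (min b x) :=
    (LipschitzWith.id.const_min b).const_max (-b)
  have hp : LipschitzWith 1 fun (x : Fin n → ℝ) i => max (-b) (min b (x i)) := by
    refine LipschitzWith.of_dist_le_mul fun x y => ?_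
    rw [NNReal.coe_one, one_mul]
    refine (dist_pi_le_iff dist_nonneg).2 fun i => ?_
    have := hr.dist_le_mul (x i) (y i)
    rw [NNReal.coe_one, one_mul] at this
    exact this.trans (dist_le_pi_dist x y i)
  have h1 := hp.comp (LipschitzWith.prod_fst (α := Fin n → ℝ) (β := ℝ))
  have h2 := hr.comp (LipschitzWith.prod_snd (α := Fin n → ℝ) (β := ℝ))
  have h3 := (hp.comp LipschitzWith.prod_fst).prodMk
    ((h1.prodMk h2).comp (LipschitzWith.prod_snd (α := Fin n → ℝ)))
  have h4 := (hp.comp LipschitzWith.prod_fst).prodMk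
    (h3.comp (LipschitzWith.prod_snd (α := Fin n → ℝ)))
  simp only [mul_one, max_self] at h4
  exact h4

theorem truncate_eq {b : ℝ} {X : State n} (hX : ‖X‖ ≤ b) : truncate b X = X := by
  have hr {x : ℝ} (hx : ‖x‖ ≤ b) : max (-b) (min b x) = x := by
    have := abs_le.1 hx
    rw [min_eq_right this.2, max_eq_right this.1]
  have hp {x : Fin n → ℝ} (hx : ‖x‖ ≤ b) : (fun i => max (-b) (min b (x i))) = x := by
    ext i
    exact hr ((norm_le_pi_norm x i).trans hx)
  have h1 : ‖X.1‖ ≤ b := (norm_fst_le X).trans hX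
  have h2 : ‖X.2‖ ≤ b := (norm_snd_le X).trans hX
  have h3 : ‖X.2.1‖ ≤ b := (norm_fst_le X.2).trans h2
  have h4 : ‖X.2.2‖ ≤ b := (norm_snd_le X.2).trans h2
  have h5 : ‖X.2.2.1‖ ≤ b := (norm_fst_le X.2.2).trans h4
  have h6 : ‖X.2.2.2‖ ≤ b := (norm_snd_le X.2.2).trans h4
  rw [truncate, hp h1, hp h3, hp h5, hr h6]

theorem norm_truncate_le {b : ℝ} (hb : 0 ≤ b) (X : State n) : ‖truncate b X‖ ≤ b := by
  have hr (x : ℝ) : ‖max (-b) (min b x)‖ ≤ b :=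
    abs_le.2 ⟨le_max_left _ _, max_le (by linarith) (min_le_left _ _)⟩
  have hp (x : Fin n → ℝ) : ‖(fun i => max (-b) (min b (x i)))‖ ≤ b :=
    (pi_norm_le_iff_of_nonneg hb).2 fun i => hr _
  exact norm_prod_le_iff.2 ⟨hp _, norm_prod_le_iff.2 ⟨hp _, norm_prod_le_iff.2 ⟨hp _, hr _⟩⟩⟩

/-- An a priori bound for the solutions on half-open intervals gives global existence. -/
theorem Loop.exists_solution (S : Loop n) {r : ℝ → ℝ} {c b : ℝ} (hr : Measurable r)
    (hc : ∀ t, 0 ≤ t → |r t| ≤ c) (X₀ : State n) (hb0 : ‖X₀‖ ≤ b)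
    (hb : ∀ (T : ℝ) (X : ℝ → State n), 0 < T → S.IsSolutionOn r X (Ico 0 T) → X 0 = X₀ →
      ∀ t ∈ Ico 0 T, ‖X t‖ ≤ b) :
    ∃ X : ℝ → State n, S.IsSolutionOn r X (Ici 0) ∧ X 0 = X₀ := by
  have hb1 : 0 ≤ b + 1 := by linarith [(norm_nonneg X₀).trans hb0]
  obtain ⟨K, hK⟩ := (S.contDiff_field.contDiffOn
    (s := Icc (-c) c ×ˢ Metric.closedBall 0 (b + 1))).exists_lipschitzOnWith (by decide)
    ((convex_Icc _ _).prod (convex_closedBall _ _)) (isCompact_Icc.prod (isCompact_closedBall _ _))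
  have hmemr (t : ℝ) : r (max t 0) ∈ Icc (-c) c := abs_le.1 (hc _ (le_max_right _ _))
  obtain ⟨D, hD⟩ := S.exists_field_bound c (b + 1)
  have hmem (t : ℝ) (Y : State n) : (r (max t 0), truncate (b + 1) Y) ∈
      Icc (-c) c ×ˢ Metric.closedBall (0 : State n) (b + 1) :=
    ⟨hmemr t, by simpa using norm_truncate_le hb1 Y⟩
  -- Truncation at b + 1 makes the field globally Lipschitz and changes nothing while ‖X‖ ≤ b + 1.
  -- Since r is bounded only on [0, ∞), it is read at max t 0.
  obtain ⟨X, hX, hXint⟩ := exists_integral_curve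
    (F := fun t Y => S.field (r (max t 0)) (truncate (b + 1) Y)) (K := K) (c := D)
    (fun t => by
      refine LipschitzWith.of_dist_le_mul fun Y Z => ?_
      refine (hK.dist_le_mul _ (hmem t Y) _ (hmem t Z)).trans ?_
      refine mul_le_mul_of_nonneg_left ?_ K.coe_nonneg
      have := (truncate_lipschitz (b + 1)).dist_le_mul Y Z
      rw [NNReal.coe_one, one_mul] at this
      simpa [Prod.dist_eq] using this)
    (fun t => hD _ _ (abs_le.2 (hmemr t)) (norm_truncate_le hb1 _))
    (fun Y hY => S.contDiff_field.continuous.comp_stronglyMeasurable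
      ((hr.comp (measurable_id.max measurable_const)).stronglyMeasurable.prodMk
        ((truncate_lipschitz (b + 1)).continuous.comp hY).stronglyMeasurable)) X₀
  have hX0 : X 0 = X₀ := by simpa using hXint 0 le_rfl
  have hsol (I : Set ℝ) (hI : ∀ t ∈ I, 0 ≤ t ∧ ∀ s, 0 ≤ s → s ≤ t → ‖X s‖ ≤ b + 1) :
      S.IsSolutionOn r X I := by
    refine ⟨hX.continuousOn, fun t ht => ?_⟩
    rw [hX0, hXint t (hI t ht).1]
    congr 1
    refine intervalIntegral.integral_congr fun s hs => ?_
    rw [uIcc_of_le (hI t ht).1] at hs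
    rw [max_eq_left hs.1, truncate_eq ((hI t ht).2 s hs.1 hs.2)]
  -- Before the first time T with ‖X T‖ ≥ b + 1, X solves the true equation, so the a priori bound
  -- and continuity give ‖X T‖ ≤ b.
  have hlt : ∀ t, 0 ≤ t → ‖X t‖ < b + 1 := by
    by_contra! hcon
    obtain ⟨t₁, ht₁, hge⟩ := hcon
    set A : Set ℝ := Icc 0 t₁ ∩ {t | b + 1 ≤ ‖X t‖} with hA
    have hcl : IsCompact A := isCompact_Icc.inter_right (isClosed_le continuous_const hX.norm)
    have hm := hcl.sInf_mem ⟨t₁, ⟨ht₁, le_rfl⟩, hge⟩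
    set T := sInf A with hT
    have hT0 : 0 < T := by
      refine lt_of_le_of_ne hm.1.1 fun h => ?_
      have : b + 1 ≤ ‖X T‖ := hm.2
      rw [← h, hX0] at this
      linarith
    have hbelow : ∀ s, 0 ≤ s → s < T → ‖X s‖ ≤ b + 1 := by
      intro s hs hsT
      by_contra! hgt
      exact absurd (csInf_le hcl.bddBelow (⟨⟨hs, hsT.le.trans hm.1.2⟩, hgt.le⟩ : s ∈ A))
        (not_le.2 hsT)
    have hbd := hb T X hT0 (hsol _ fun t ht => ⟨ht.1, fun s hs hst =>
      hbelow s hs (hst.trans_lt ht.2)⟩) hX0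
    have hclosure : T ∈ closure (Ico 0 T) := by
      rw [closure_Ico hT0.ne]
      exact ⟨hT0.le, le_rfl⟩
    have hle : ‖X T‖ ≤ b :=
      closure_minimal (s := Ico 0 T) (t := {t | ‖X t‖ ≤ b}) hbd
        (isClosed_le hX.norm continuous_const) hclosure
    have : b + 1 ≤ ‖X T‖ := hm.2
    linarith
  exact ⟨X, hsol _ fun t ht => ⟨ht, fun s hs _ => (hlt s hs).le⟩, hX0⟩

end Existence

end AdaptiveSISO

namespace AdaptiveSISO

variable {n : ℕ}

theorem _root_.HasDerivAt.prod_fst {E F : Type*} [NormedAddCommGroup E] [NormedSpace ℝ E]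
    [NormedAddCommGroup F] [NormedSpace ℝ F] {f : ℝ → E × F} {f' : E × F} {t : ℝ}
    (h : HasDerivAt f f' t) : HasDerivAt (fun s => (f s).1) f'.1 t := by
  simpa using h.hasFDerivAt.fst.hasDerivAt

theorem _root_.HasDerivAt.prod_snd {E F : Type*} [NormedAddCommGroup E] [NormedSpace ℝ E]
    [NormedAddCommGroup F] [NormedSpace ℝ F] {f : ℝ → E × F} {f' : E × F} {t : ℝ}
    (h : HasDerivAt f f' t) : HasDerivAt (fun s => (f s).2) f'.2 t := by
  simpa using h.hasFDerivAt.snd.hasDerivAt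

/-! ### The energy and its dissipation -/

section Energy

/-- The Lyapunov function `eᵀ P e + Λ (Θ - Θ*)ᵀ D (Θ - Θ*) + Λ (K - K*)² / γ` of the closed loop,
where `e = x - x_m`. -/
def energy (P D : Matrix (Fin n) (Fin n) ℝ) (lam γk : ℝ) (Θs : Fin n → ℝ) (Ks : ℝ)
    (X : State n) : ℝ :=
  (X.1 - X.2.1) ⬝ᵥ (P *ᵥ (X.1 - X.2.1)) +
    lam * ((X.2.2.1 - Θs) ⬝ᵥ (D *ᵥ (X.2.2.1 - Θs)) + (X.2.2.2 - Ks) ^ 2 / γk)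

/-- The derivative of `energy` at the state `X` in the direction `v`. -/
def energyDeriv (P D : Matrix (Fin n) (Fin n) ℝ) (lam γk : ℝ) (Θs : Fin n → ℝ) (Ks : ℝ)
    (X v : State n) : ℝ :=
  2 * ((X.1 - X.2.1) ⬝ᵥ (P *ᵥ (v.1 - v.2.1))) +
    lam * (2 * ((X.2.2.1 - Θs) ⬝ᵥ (D *ᵥ v.2.2.1)) + 2 * (X.2.2.2 - Ks) * v.2.2.2 / γk)

theorem contDiff_energy (P D : Matrix (Fin n) (Fin n) ℝ) (lam γk : ℝ) (Θs : Fin n → ℝ) (Ks : ℝ) :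
    ContDiff ℝ 1 (energy P D lam γk Θs Ks) := by
  have h1 : ContDiff ℝ 1 fun X : State n => X.1 - X.2.1 := by fun_prop
  have h2 : ContDiff ℝ 1 fun X : State n => X.2.2.1 - Θs := by fun_prop
  have h3 : ContDiff ℝ 1 fun X : State n => (X.2.2.2 - Ks) ^ 2 / γk := by fun_prop
  exact ((contDiff_quadraticForm P).comp h1).add
    (contDiff_const.mul (((contDiff_quadraticForm D).comp h2).add h3))

theorem hasDerivAt_energy {P D : Matrix (Fin n) (Fin n) ℝ} (hP : Pᵀ = P) (hD : Dᵀ = D)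
    (lam γk : ℝ) (Θs : Fin n → ℝ) (Ks : ℝ) (Y : ℝ → State n) (v : State n) (t : ℝ)
    (hY : HasDerivAt Y v t) :
    HasDerivAt (fun s => energy P D lam γk Θs Ks (Y s)) (energyDeriv P D lam γk Θs Ks (Y t) v) t := by
  have h1 : HasDerivAt (fun s => (Y s).1 - (Y s).2.1) (v.1 - v.2.1) t :=
    hY.prod_fst.sub hY.prod_snd.prod_fst
  have h2 : HasDerivAt (fun s => (Y s).2.2.1 - Θs) v.2.2.1 t := hY.prod_snd.prod_snd.prod_fst.sub_const Θs
  have h3 : HasDerivAt (fun s => (Y s).2.2.2 - Ks) v.2.2.2 t := hY.prod_snd.prod_snd.prod_snd.sub_const Ks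
  have h4 := ((h3.pow 2).div_const γk)
  refine ((hasDerivAt_quadraticForm hP h1).add
    (((hasDerivAt_quadraticForm hD h2).add h4).const_mul lam)).congr_deriv ?_
  simp only [energyDeriv]
  norm_num

variable {A Am P Qs : Matrix (Fin n) (Fin n) ℝ} {B C Θs Ls γθ : Fin n → ℝ}
  {lam Ks γk lambar θbar ρ : ℝ}

/-- The closed loop of the adaptive controller with reference model gain `Ls - ρ B M`. -/
def closedLoop (A Am : Matrix (Fin n) (Fin n) ℝ) (B C : Fin n → ℝ) (lam : ℝ) (Ls : Fin n → ℝ)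
    (ρ : ℝ) (γθ : Fin n → ℝ) (γk : ℝ) : Loop n :=
  { A := A, B := B, C := C, lam := lam, Am := Am, L := Ls - (ρ * (C ⬝ᵥ B)) • B, M := C ⬝ᵥ B,
    Γθ := Matrix.diagonal γθ, Γk := γk }

/-- Since PB = CM, the update laws cancel the parameter errors in the error dynamics. What remains
are Q_s, the ρ part of L, and the mismatch Θ*ᵀe. -/
theorem energyDeriv_field (h4 : A + lam • vecMulVec B Θs = Am) (h4' : lam * Ks = 1)
    (hγθ : ∀ i, 0 < γθ i) (hγk : 0 < γk) (hPQ : IsLyapunovPair Am B C Ls P Qs) (r : ℝ)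
    (X : State n) :
    energyDeriv P (Matrix.diagonal γθ⁻¹) lam γk Θs Ks X
        ((closedLoop A Am B C lam Ls ρ γθ γk).field r X) =
      -((X.1 - X.2.1) ⬝ᵥ (Qs *ᵥ (X.1 - X.2.1))) -
        2 * ρ * ((C ⬝ᵥ B) * (C ⬝ᵥ (X.1 - X.2.1))) ^ 2 -
        2 * ((C ⬝ᵥ B) * (C ⬝ᵥ (X.1 - X.2.1))) * (lam * (Θs ⬝ᵥ (X.1 - X.2.1))) := by
  obtain ⟨x, xm, Θ, K⟩ := X
  obtain ⟨hP, hQ, hlyap, hPB⟩ := hPQ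
  have hPT := PosDef.transpose_eq hP
  set e := x - xm with he
  set M := C ⬝ᵥ B with hM
  set ey := C ⬝ᵥ e with hey
  have hey' : C ⬝ᵥ x - C ⬝ᵥ xm = ey := by rw [hey, he, dotProduct_sub]
  have hlyap' : e ⬝ᵥ (Qs *ᵥ e) = -(2 * (e ⬝ᵥ (P *ᵥ (Am *ᵥ e + ey • Ls)))) := by
    have hF : (Am + vecMulVec Ls C) *ᵥ e = Am *ᵥ e + ey • Ls := by
      rw [Matrix.add_mulVec, vecMulVec_mulVec, op_smul_eq_smul]
    have : e ⬝ᵥ (((Am + vecMulVec Ls C)ᵀ * P + P * (Am + vecMulVec Ls C)) *ᵥ e) =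
        e ⬝ᵥ (-Qs *ᵥ e) := by rw [hlyap]
    rw [Matrix.add_mulVec, ← Matrix.mulVec_mulVec, ← Matrix.mulVec_mulVec, dotProduct_add,
      dotProduct_transpose_mulVec, dotProduct_comm (P *ᵥ e), dotProduct_mulVec_comm hPT _ e, hF,
      Matrix.neg_mulVec, dotProduct_neg] at this
    linarith
  have hA : A *ᵥ x = Am *ᵥ x - (lam * (Θs ⬝ᵥ x)) • B := by
    rw [← h4, Matrix.add_mulVec, Matrix.smul_mulVec, vecMulVec_mulVec, op_smul_eq_smul, smul_smul,
      add_sub_cancel_right]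
  -- The error dynamics; ΛK* = 1 turns r into ΛK*r.
  have hv : (A *ᵥ x + (lam * (Θ ⬝ᵥ xm + K * r)) • B) -
      (Am *ᵥ xm + r • B - ey • (Ls - (ρ * M) • B)) =
      (Am *ᵥ e + ey • Ls) + (lam * ((Θ - Θs) ⬝ᵥ xm + (K - Ks) * r) - lam * (Θs ⬝ᵥ e) -
        ρ * M * ey) • B := by
    have hr : lam * ((Θ - Θs) ⬝ᵥ xm + (K - Ks) * r) =
        lam * (Θ ⬝ᵥ xm + K * r) - lam * (Θs ⬝ᵥ xm) - r := by
      rw [sub_dotProduct]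
      linear_combination -r * h4'
    rw [hr, hA, he, Matrix.mulVec_sub, dotProduct_sub]
    ext i
    simp only [Pi.add_apply, Pi.sub_apply, Pi.smul_apply, smul_eq_mul]
    ring
  have hPBe : e ⬝ᵥ (P *ᵥ B) = M * ey := by
    rw [hPB, dotProduct_smul, smul_eq_mul, dotProduct_comm]
  have hD : (Θ - Θs) ⬝ᵥ (Matrix.diagonal γθ⁻¹ *ᵥ -((ey * M) • (Matrix.diagonal γθ *ᵥ xm))) =
      -(ey * M * ((Θ - Θs) ⬝ᵥ xm)) := by
    have : Matrix.diagonal γθ⁻¹ *ᵥ (Matrix.diagonal γθ *ᵥ xm) = xm := by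
      ext i
      rw [mulVec_diagonal, mulVec_diagonal, Pi.inv_apply, inv_mul_cancel_left₀ (hγθ i).ne']
    rw [Matrix.mulVec_neg, Matrix.mulVec_smul, this, dotProduct_neg, dotProduct_smul, smul_eq_mul]
  simp only [energyDeriv, closedLoop, Loop.field, Loop.outputError, Loop.control]
  rw [← hM, hey', hv, hD, hlyap', Matrix.mulVec_add, Matrix.mulVec_smul, dotProduct_add,
    dotProduct_smul, hPBe, smul_eq_mul]
  field_simp
  ring

theorem exists_energyDeriv_le [NeZero n] (h4 : A + lam • vecMulVec B Θs = Am)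
    (h4' : lam * Ks = 1) (h6 : ‖WithLp.toLp 2 Θs‖ ≤ θbar) (h6' : |lam| ≤ lambar)
    (hγθ : ∀ i, 0 < γθ i) (hγk : 0 < γk) (hPQ : IsLyapunovPair Am B C Ls P Qs)
    (hρ : lambar ^ 2 * θbar ^ 2 / (2 * minEigenvalue Qs) < ρ) :
    ∃ c : ℝ, 0 < c ∧ ∀ (r : ℝ) (X : State n),
      energyDeriv P (Matrix.diagonal γθ⁻¹) lam γk Θs Ks X
        ((closedLoop A Am B C lam Ls ρ γθ γk).field r X) ≤
        -(c * ((X.1 - X.2.1) ⬝ᵥ (X.1 - X.2.1))) := by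
  have hq := PosDef.minEigenvalue_pos hPQ.2.1
  set q := minEigenvalue Qs with hqdef
  have hρ0 : 0 < ρ := lt_of_le_of_lt (by positivity) hρ
  -- With a = ΛΘ*ᵀe and m = M e_y, completing the square gives -2ρm² - 2ma ≤ a²/(2ρ). This constant
  -- is positive exactly when ρ > ρ*.
  refine ⟨q - lambar ^ 2 * θbar ^ 2 / (2 * ρ), ?_, fun r X => ?_⟩
  · rw [div_lt_iff₀ (by positivity)] at hρ
    rw [sub_pos, div_lt_iff₀ (by positivity)]
    linarith
  rw [energyDeriv_field h4 h4' hγθ hγk hPQ]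
  set e := X.1 - X.2.1
  set m := (C ⬝ᵥ B) * (C ⬝ᵥ e)
  have hQe := minEigenvalue_mul_le hPQ.2.1.isHermitian e
  have hee := real_dotProduct_self_nonneg e
  have hΘ : Θs ⬝ᵥ Θs ≤ θbar ^ 2 := by
    have h := pow_le_pow_left₀ (norm_nonneg _) h6 2
    rw [EuclideanSpace.norm_sq_eq] at h
    simpa [dotProduct, pow_two] using h
  have hlam : lam ^ 2 ≤ lambar ^ 2 := by
    rw [← sq_abs]
    exact pow_le_pow_left₀ (abs_nonneg _) h6' 2
  have hle : (lam * (Θs ⬝ᵥ e)) ^ 2 ≤ lambar ^ 2 * θbar ^ 2 * (e ⬝ᵥ e) := by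
    rw [mul_pow, mul_assoc]
    refine mul_le_mul hlam ?_ (sq_nonneg _) (sq_nonneg _)
    exact (dotProduct_sq_le Θs e).trans (mul_le_mul_of_nonneg_right hΘ hee)
  have hyoung : -(2 * ρ * m ^ 2) - 2 * m * (lam * (Θs ⬝ᵥ e)) ≤
      lambar ^ 2 * θbar ^ 2 / (2 * ρ) * (e ⬝ᵥ e) := by
    rw [div_mul_eq_mul_div, le_div_iff₀ (by positivity)]
    nlinarith [sq_nonneg (2 * ρ * m + lam * (Θs ⬝ᵥ e))]
  rw [← hqdef] at hQe
  nlinarith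

theorem energy_nonneg {D : Matrix (Fin n) (Fin n) ℝ} (hP : P.PosDef) (hD : D.PosDef)
    (h5 : 0 < lam) (hγk : 0 < γk) (X : State n) : 0 ≤ energy P D lam γk Θs Ks X := by
  have h1 := PosDef.nonneg hP (X.1 - X.2.1)
  have h2 := PosDef.nonneg hD (X.2.2.1 - Θs)
  rw [energy]
  positivity

/-- The sublevel sets of the energy bound the tracking and the parameter errors. -/
theorem exists_bound_of_energy_le [NeZero n] {D : Matrix (Fin n) (Fin n) ℝ} (hP : P.PosDef)
    (hD : D.PosDef) (h5 : 0 < lam) (hγk : 0 < γk) (Θs : Fin n → ℝ) (Ks v : ℝ) :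
    ∃ b : ℝ, ∀ X : State n, energy P D lam γk Θs Ks X ≤ v →
      ‖X.1 - X.2.1‖ ≤ b ∧ ‖X.2.2.1‖ ≤ b ∧ ‖X.2.2.2‖ ≤ b := by
  refine ⟨max (√(v / minEigenvalue P)) (max (√(v / lam / minEigenvalue D) + ‖Θs‖)
    (√(v / lam * γk) + ‖Ks‖)), fun X hX => ?_⟩
  have h1 := PosDef.nonneg hP (X.1 - X.2.1)
  have h2 := PosDef.nonneg hD (X.2.2.1 - Θs)
  have h3 : 0 ≤ (X.2.2.2 - Ks) ^ 2 / γk := by positivity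
  rw [energy] at hX
  have hsum : 0 ≤ lam * ((X.2.2.1 - Θs) ⬝ᵥ (D *ᵥ (X.2.2.1 - Θs)) + (X.2.2.2 - Ks) ^ 2 / γk) := by
    positivity
  have hpar : (X.2.2.1 - Θs) ⬝ᵥ (D *ᵥ (X.2.2.1 - Θs)) + (X.2.2.2 - Ks) ^ 2 / γk ≤ v / lam := by
    rw [le_div_iff₀ h5, mul_comm]
    exact (le_add_of_nonneg_left h1).trans hX
  refine ⟨le_max_of_le_left (PosDef.norm_le hP ((le_add_of_nonneg_right hsum).trans hX)),
    le_max_of_le_right (le_max_of_le_left ?_), le_max_of_le_right (le_max_of_le_right ?_)⟩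
  · have := PosDef.norm_le hD ((le_add_of_nonneg_right h3).trans hpar)
    have h := norm_add_le (X.2.2.1 - Θs) Θs
    rw [sub_add_cancel] at h
    linarith
  · have h4 : (X.2.2.2 - Ks) ^ 2 ≤ v / lam * γk := by
      rw [← div_le_iff₀ hγk]
      exact (le_add_of_nonneg_left h2).trans hpar
    have := Real.abs_le_sqrt h4
    have h := norm_add_le (X.2.2.2 - Ks) Ks
    rw [sub_add_cancel] at h
    rw [← Real.norm_eq_abs] at this
    linarith

end Energy

/-! ### Boundedness of the reference model -/

section ReferenceModel

/-- The state of a Hurwitz reference model stays bounded as long as its forcing is bounded. -/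
theorem IsHurwitz.exists_referenceModel_bound [NeZero n] {S : Loop n} (hS : IsHurwitz S.Am)
    (c b R : ℝ) :
    ∃ b' : ℝ, ∀ (r : ℝ → ℝ) (X : ℝ → State n) (I : Set ℝ) (T : ℝ), Measurable r →
      (∀ t, 0 ≤ t → |r t| ≤ c) → S.IsSolutionOn r X I → 0 ≤ T → Icc 0 T ⊆ I → ‖(X 0).2.1‖ ≤ R →
      (∀ t ∈ Icc 0 T, ‖(X t).1 - (X t).2.1‖ ≤ b) → ‖(X T).2.1‖ ≤ b' := by
  obtain ⟨P, hP, a, ha, hdec⟩ := hS.exists_lyapunov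
  have hPT := PosDef.transpose_eq hP
  let d (ρ : ℝ) (e : Fin n → ℝ) : Fin n → ℝ := ρ • S.B - (S.C ⬝ᵥ e) • S.L
  have hd : Continuous fun p : ℝ × (Fin n → ℝ) => (P *ᵥ d p.1 p.2) ⬝ᵥ (P *ᵥ d p.1 p.2) := by
    simp only [d, dotProduct, mulVec]
    fun_prop
  obtain ⟨δ, hδ⟩ := ((isCompact_Icc (a := -c) (b := c)).prod
    (isCompact_closedBall (0 : Fin n → ℝ) b)).exists_bound_of_continuousOn hd.continuousOn
  -- Above level k the state lies outside a ball containing the admissible initial values and every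
  -- x with a²|x|² ≤ δ. There a|x|² dominates the forcing term xᵀPd by Cauchy–Schwarz.
  obtain ⟨k, hk⟩ := (isCompact_closedBall (0 : Fin n → ℝ)
    (max R (√(δ / a ^ 2)))).exists_bound_of_continuousOn (continuous_quadraticForm P).continuousOn
  refine ⟨√(k / minEigenvalue P), fun r X I T hr hc hX hT hI hR hb => PosDef.norm_le hP ?_⟩
  refine hX.le_of_field hT hI hr hc (φ := fun X => X.2.1 ⬝ᵥ (P *ᵥ X.2.1))
    (φ' := fun X v => 2 * (X.2.1 ⬝ᵥ (P *ᵥ v.2.1))) ((contDiff_quadraticForm P).comp (by fun_prop))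
    (fun Y v t hY => hasDerivAt_quadraticForm hPT hY.prod_snd.prod_fst) ?_ fun t ht hlt => ?_
  · exact (le_abs_self _).trans (hk _ (by simpa using Or.inl hR))
  · set x := (X t).2.1 with hx
    set e := (X t).1 - (X t).2.1 with he
    have hfield : (S.field (r t) (X t)).2.1 = S.Am *ᵥ x + d (r t) e := by
      simp only [d]
      rw [he, dotProduct_sub, ← add_sub_assoc]
      rfl
    rw [hfield, Matrix.mulVec_add, dotProduct_add]
    have hfar : δ < a ^ 2 * (x ⬝ᵥ x) := by
      by_contra! hle
      have h1 : x ⬝ᵥ x ≤ δ / a ^ 2 := by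
        rw [le_div_iff₀ (by positivity), mul_comm]
        exact hle
      have h2 := hk x (by simpa using Or.inr (norm_le_of_dotProduct_le h1))
      exact absurd ((le_abs_self _).trans h2) (not_le.2 hlt)
    have hforce : (P *ᵥ d (r t) e) ⬝ᵥ (P *ᵥ d (r t) e) ≤ δ :=
      (le_abs_self _).trans (hδ (r t, e) ⟨abs_le.1 (hc t ht.1), by simpa using hb t ht⟩)
    have hcs := dotProduct_sq_le x (P *ᵥ d (r t) e)
    have hxx := real_dotProduct_self_nonneg x
    have hsq : (x ⬝ᵥ (P *ᵥ d (r t) e)) ^ 2 ≤ (a * (x ⬝ᵥ x)) ^ 2 := by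
      refine hcs.trans ?_
      have := mul_le_mul_of_nonneg_left (hforce.trans hfar.le) hxx
      nlinarith
    have h1 := le_of_abs_le (abs_le_of_sq_le_sq hsq (by positivity))
    have h2 := hdec x
    linarith

end ReferenceModel

end AdaptiveSISO

/-! ### Uniform boundedness and output tracking -/

namespace AdaptiveSISO

variable {n : ℕ} {A Am P Qs : Matrix (Fin n) (Fin n) ℝ} {B C Θs Ls γθ : Fin n → ℝ}
  {lam Ks γk lambar θbar ρ : ℝ}

/-- Uniform boundedness of the solutions of the adaptive closed loop. -/
theorem exists_closedLoop_bound [NeZero n] (h4 : A + lam • vecMulVec B Θs = Am)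
    (h4' : lam * Ks = 1) (h5 : 0 < lam) (h6 : ‖WithLp.toLp 2 Θs‖ ≤ θbar) (h6' : |lam| ≤ lambar)
    (hAm : IsHurwitz Am) (hγθ : ∀ i, 0 < γθ i) (hγk : 0 < γk)
    (hPQ : IsLyapunovPair Am B C Ls P Qs)
    (hρ : lambar ^ 2 * θbar ^ 2 / (2 * minEigenvalue Qs) < ρ) {r : ℝ → ℝ} {c : ℝ}
    (hr : Measurable r) (hc : ∀ t, 0 ≤ t → |r t| ≤ c) (R : ℝ) :
    ∃ b : ℝ, ∀ (I : Set ℝ) (X : ℝ → State n), I.OrdConnected → 0 ∈ I → I ⊆ Ici 0 →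
      (closedLoop A Am B C lam Ls ρ γθ γk).IsSolutionOn r X I → ‖X 0‖ ≤ R →
      ∀ t ∈ I, ‖X t‖ ≤ b := by
  set D : Matrix (Fin n) (Fin n) ℝ := Matrix.diagonal γθ⁻¹ with hDdef
  have hD : D.PosDef := Matrix.PosDef.diagonal fun i => inv_pos.2 (hγθ i)
  obtain ⟨a, ha, hdec⟩ := exists_energyDeriv_le h4 h4' h6 h6' hγθ hγk hPQ hρ
  have hE := contDiff_energy P D lam γk Θs Ks
  -- The largest initial energy depends only on R, which makes the final bound uniform over
  -- solutions.
  obtain ⟨v, hv⟩ := (isCompact_closedBall (0 : State n) R).exists_bound_of_continuousOn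
    hE.continuous.continuousOn
  obtain ⟨b₁, hb₁⟩ := exists_bound_of_energy_le hPQ.1 hD h5 hγk Θs Ks v
  obtain ⟨b₂, hb₂⟩ := IsHurwitz.exists_referenceModel_bound
    (S := closedLoop A Am B C lam Ls ρ γθ γk) hAm c b₁ R
  refine ⟨b₁ + b₂, fun I X hI h0 hI0 hX hR T hT => ?_⟩
  have hsub {t : ℝ} (ht : t ∈ I) : Icc 0 t ⊆ I := hI.out h0 ht
  have hen {t : ℝ} (ht : t ∈ I) : energy P D lam γk Θs Ks (X t) ≤ v :=
    hX.le_of_field (hI0 ht) (hsub ht) hr hc hE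
      (hasDerivAt_energy (PosDef.transpose_eq hPQ.1) (PosDef.transpose_eq hD) lam γk Θs Ks)
      ((le_abs_self _).trans (hv _ (by simpa using hR))) fun s _ _ =>
        (hdec _ _).trans (neg_nonpos.2 (mul_nonneg ha.le (real_dotProduct_self_nonneg _)))
  obtain ⟨he, hΘ, hK⟩ := hb₁ _ (hen hT)
  have hxm : ‖(X T).2.1‖ ≤ b₂ := hb₂ r X I T hr hc hX (hI0 hT) (hsub hT)
    (((norm_fst_le (X 0).2).trans (norm_snd_le (X 0))).trans hR)
    fun t ht => (hb₁ _ (hen (hsub hT ht))).1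
  have hb₁0 := (norm_nonneg _).trans he
  have hb₂0 := (norm_nonneg _).trans hxm
  have hx : ‖(X T).1‖ ≤ b₁ + b₂ := by
    have h := norm_add_le ((X T).1 - (X T).2.1) (X T).2.1
    rw [sub_add_cancel] at h
    linarith
  exact norm_prod_le_iff.2 ⟨hx, norm_prod_le_iff.2 ⟨by linarith,
    norm_prod_le_iff.2 ⟨by linarith, by linarith⟩⟩⟩

/-- Asymptotic output tracking of the adaptive closed loop. -/
theorem tendsto_outputError [NeZero n] (h1 : C ⬝ᵥ B ≠ 0) (h4 : A + lam • vecMulVec B Θs = Am)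
    (h4' : lam * Ks = 1) (h5 : 0 < lam) (h6 : ‖WithLp.toLp 2 Θs‖ ≤ θbar) (h6' : |lam| ≤ lambar)
    (hAm : IsHurwitz Am) (hγθ : ∀ i, 0 < γθ i) (hγk : 0 < γk)
    (hPQ : IsLyapunovPair Am B C Ls P Qs)
    (hρ : lambar ^ 2 * θbar ^ 2 / (2 * minEigenvalue Qs) < ρ) {r : ℝ → ℝ} {c : ℝ}
    (hr : Measurable r) (hc : ∀ t, 0 ≤ t → |r t| ≤ c) {X : ℝ → State n}
    (hX : (closedLoop A Am B C lam Ls ρ γθ γk).IsSolutionOn r X (Ici 0)) :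
    Tendsto (fun t => (closedLoop A Am B C lam Ls ρ γθ γk).outputError (X t)) atTop (𝓝 0) := by
  set S := closedLoop A Am B C lam Ls ρ γθ γk with hS
  set D : Matrix (Fin n) (Fin n) ℝ := Matrix.diagonal γθ⁻¹ with hDdef
  have hD : D.PosDef := Matrix.PosDef.diagonal fun i => inv_pos.2 (hγθ i)
  obtain ⟨a, ha, hdec⟩ := exists_energyDeriv_le h4 h4' h6 h6' hγθ hγk hPQ hρ
  obtain ⟨b, hb⟩ := exists_closedLoop_bound h4 h4' h5 h6 h6' hAm hγθ hγk hPQ hρ hr hc ‖X 0‖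
  have hXb : ∀ t, 0 ≤ t → ‖X t‖ ≤ b := hb (Ici 0) X ordConnected_Ici self_mem_Ici subset_rfl hX le_rfl
  obtain ⟨K, hK⟩ := S.exists_field_bound c b
  have hlip : LipschitzOnWith K.toNNReal X (Ici 0) := by
    intro s hs t ht
    have hm : 0 ≤ max s t := le_max_of_le_left hs
    have hsub : Icc 0 (max s t) ⊆ Ici 0 := fun u hu => hu.1
    exact lipschitzOnWith_of_integral (fun u hu => hX.2 u (hsub hu))
      (hX.exists_bound hm hsub hr hc).1 (fun u hu => hK _ _ (hc u hu.1) (hXb u hu.1))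
      ⟨hs, le_max_left _ _⟩ ⟨ht, le_max_right _ _⟩
  have hout (Y : State n) : S.outputError Y = C ⬝ᵥ (Y.1 - Y.2.1) := (dotProduct_sub _ _ _).symm
  obtain ⟨L, hL⟩ : ∃ L : NNReal, LipschitzOnWith L S.outputError (Metric.closedBall 0 b) := by
    refine ContDiffOn.exists_lipschitzOnWith (n := 1) (ContDiff.contDiffOn ?_) (by decide)
      (convex_closedBall _ _) (isCompact_closedBall _ _)
    rw [funext hout]
    simp only [dotProduct]
    fun_prop
  have hf : LipschitzOnWith (L * K.toNNReal) (fun t => S.outputError (X t)) (Ici 0) :=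
    hL.comp hlip fun t ht => by simpa using hXb t ht
  have hCC : 0 < C ⬝ᵥ C := by
    refine lt_of_le_of_ne (real_dotProduct_self_nonneg C) (Ne.symm ?_)
    rw [Ne, dotProduct_self_eq_zero]
    rintro rfl
    exact h1 (zero_dotProduct B)
  -- e_y² ≤ |C|²|e|², so energy dissipation at rate a|e|² gives rate a/|C|² for e_y².
  refine tendsto_zero_of_dissipation (W := fun t => energy P D lam γk Θs Ks (X t))
    (div_pos ha hCC) hf (fun t _ => energy_nonneg hPQ.1 hD h5 hγk _) fun s t hs hst => ?_
  have ht : 0 ≤ t := hs.trans hst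
  have hsub : Icc 0 t ⊆ Ici 0 := fun u hu => hu.1
  obtain ⟨hint, hFTC⟩ := hX.integral_comp ht hsub hr hc (contDiff_energy P D lam γk Θs Ks)
    (hasDerivAt_energy (PosDef.transpose_eq hPQ.1) (PosDef.transpose_eq hD) lam γk Θs Ks)
  have hst' : uIcc s t ⊆ uIcc 0 t := by
    rw [uIcc_of_le hst, uIcc_of_le ht]
    exact Icc_subset_Icc_left hs
  rw [← neg_sub, hFTC s ⟨hs, hst⟩ t ⟨ht, le_rfl⟩, ← intervalIntegral.integral_neg,
    ← intervalIntegral.integral_const_mul]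
  refine intervalIntegral.integral_mono_on hst ?_ (hint.mono_set hst').neg fun u hu => ?_
  · refine ContinuousOn.intervalIntegrable_of_Icc hst (continuousOn_const.mul ?_)
    exact (hf.continuousOn.mono fun u hu => hs.trans hu.1).pow 2
  · refine le_neg_of_le_neg ((hdec _ _).trans (neg_le_neg ?_))
    rw [hout, div_mul_eq_mul_div, div_le_iff₀ hCC, mul_assoc]
    refine mul_le_mul_of_nonneg_left ?_ ha.le
    rw [mul_comm]
    exact dotProduct_sq_le _ _

end AdaptiveSISO

end

theorem theorem1 {n : ℕ}
    (A Am : Matrix (Fin n) (Fin n) ℝ) (B C : Fin n → ℝ) (lam : ℝ)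
    (Θs : Fin n → ℝ) (Ks : ℝ) (θbar lambar : ℝ)
    (γθ : Fin n → ℝ) (γk : ℝ) (r : ℝ → ℝ)
    (h1 : C ⬝ᵥ B ≠ 0)
    (h2 : AdaptiveSISO.IsObservable Am C)
    (h3 : AdaptiveSISO.IsMinimumPhase A (lam • B) C)
    (h4 : A + lam • vecMulVec B Θs = Am) (h4' : lam * Ks = 1)
    (h5 : 0 < lam)
    (h6 : ‖WithLp.toLp 2 Θs‖ ≤ θbar) (h6' : |lam| ≤ lambar)
    (hAm : AdaptiveSISO.IsHurwitz Am)
    (hr : Measurable r) (hrb : ∃ c : ℝ, ∀ t : ℝ, 0 ≤ t → |r t| ≤ c)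
    (hγθ : ∀ i, 0 < γθ i) (hγk : 0 < γk) :
    (∀ σ : ℝ, 0 < σ → ∃ Ls : Fin n → ℝ, AdaptiveSISO.PlacesSinglePole Am B C Ls σ) ∧
    ∀ σ : ℝ, 0 < σ → ∀ Ls : Fin n → ℝ, AdaptiveSISO.PlacesSinglePole Am B C Ls σ →
      (∃ P Qs : Matrix (Fin n) (Fin n) ℝ, AdaptiveSISO.IsLyapunovPair Am B C Ls P Qs) ∧
      ∀ P Qs : Matrix (Fin n) (Fin n) ℝ, AdaptiveSISO.IsLyapunovPair Am B C Ls P Qs →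
      ∀ ρ : ℝ, lambar ^ 2 * θbar ^ 2 / (2 * AdaptiveSISO.minEigenvalue Qs) < ρ →
      ∀ S : AdaptiveSISO.Loop n,
        S = { A := A, B := B, C := C, lam := lam, Am := Am,
              L := Ls - (ρ * (C ⬝ᵥ B)) • B, M := C ⬝ᵥ B,
              Γθ := Matrix.diagonal γθ, Γk := γk } →
        (∀ X₀ : AdaptiveSISO.State n, ∃ X : ℝ → AdaptiveSISO.State n,
          S.IsSolutionOn r X (Ici 0) ∧ X 0 = X₀) ∧
        (∀ R : ℝ, ∃ b : ℝ, ∀ (I : Set ℝ) (X : ℝ → AdaptiveSISO.State n),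
          I.OrdConnected → 0 ∈ I → I ⊆ Ici 0 → S.IsSolutionOn r X I → ‖X 0‖ ≤ R →
          ∀ t ∈ I, ‖X t‖ ≤ b) ∧
        (∀ X : ℝ → AdaptiveSISO.State n, S.IsSolutionOn r X (Ici 0) →
          Tendsto (fun t => S.outputError (X t)) atTop (𝓝 0)) := by
  have hn : NeZero n := ⟨by rintro rfl; exact h1 (by simp [dotProduct])⟩
  obtain ⟨c, hc⟩ := hrb
  refine ⟨fun σ _ => AdaptiveSISO.exists_placesSinglePole h1 h2 σ, fun σ hσ Ls hLs => ⟨?_, ?_⟩⟩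
  · refine AdaptiveSISO.exists_isLyapunovPair h1 h2 (fun s hs => h3 s ?_) hσ hLs
    -- A_m arises from A by state feedback, so the minimum phase property carries over to A_m.
    have hnum : AdaptiveSISO.numerator Am B C = AdaptiveSISO.numerator A B C := by
      rw [← h4, ← vecMulVec_smul, AdaptiveSISO.numerator_stateFeedback]
    rw [AdaptiveSISO.zeroPolynomial_eq_aeval, AdaptiveSISO.numerator_smul_left, map_mul, ← hnum, hs,
      mul_zero]
  · rintro P Qs hPQ ρ hρ S rfl
    have hbound := AdaptiveSISO.exists_closedLoop_bound h4 h4' h5 h6 h6' hAm hγθ hγk hPQ hρ hr hc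
    refine ⟨fun X₀ => ?_, hbound, fun X hX =>
      AdaptiveSISO.tendsto_outputError h1 h4 h4' h5 h6 h6' hAm hγθ hγk hPQ hρ hr hc hX⟩
    obtain ⟨b, hb⟩ := hbound ‖X₀‖
    refine AdaptiveSISO.Loop.exists_solution _ (b := max b ‖X₀‖) hr hc X₀ (le_max_right _ _)
      fun T X hT hX h0 t ht => le_max_of_le_left ?_
    exact hb _ X ordConnected_Ico ⟨le_rfl, hT⟩ (fun s hs => hs.1) hX (by rw [h0]) t ht
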